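/- For real $X\ge 3$ let $P$ be a uniformly random prime from the set of primes in $[X,2X]$. For $m\ge1$ and integers $0=h_0<h_1<\dots<h_m$ (an offset pattern $\mathbf h$) let $\mathcal C_{\mathbf h}(n)$ be the event that $n+h_j$ is prime for every $0\le j\le m$, let $\nu_p(\mathbf h)$ be the number of distinct residue classes modulo $p$ among $h_0,\dots,h_m$, and let $$\mathfrak S(\mathbf h)=\prod_{p\ \mathrm{prime}}\Bigl(1-\frac{\nu_p(\mathbf h)}{p}\Bigr)\Bigl(1-\frac1p\Bigr)^{-(m+1)}$$ be the singular series of $\mathbf h$ (the product converges unconditionally, to $0$ if some factor vanishes). Theorem. Fix $m\ge1$. There are constants $C_m,C_m'>0$, $A_m\in\mathbb N$ and $X_0(m)\ge 3$, depending only on $m$, such that the following hold. (i) For all real $X\ge X_0(m)$ and all offset patterns $0=h_0<h_1<\dots<h_m\le 2X$, $$\Pr[\mathcal C_{\mathbf h}(P)]\le C_m\frac{\mathfrak S(\mathbf h)}{(\log X)^m}\qquad\text{and}\qquad \frac{\mathfrak S(\mathbf h)}{(\log X)^m}\le C_m'\,\frac{(\log\log 3X)^{A_m}}{(\log X)^m}.$$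 (ii) For all real $X\ge X_0(m)$ and every finite set $\mathcal H$ of offset patterns $0=h_0<\dots<h_m\le 2X$, $$\Pr[\exists\,\mathbf h\in\mathcal H:\ \mathcal C_{\mathbf h}(P)]\le C_m'\,\frac{|\mathcal H|\,(\log\log 3X)^{A_m}}{(\log X)^m}.$$ In particular, for an arbitrary fixed finite set $\mathcal H$ of offset patterns $0=h_0<\dots<h_m$ the same bound, with the same constants $C_m'$ and $A_m$, holds for all $X\ge X_1(m,\mathcal H)$. -/

import Mathlib

open MeasureTheory ProbabilityTheory

/-- The primes in the dyadic interval `[X, 2X]`. -/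
def dyadicPrimes (X : ℝ) : Set ℕ :=
  {p : ℕ | p.Prime ∧ X ≤ (p : ℝ) ∧ (p : ℝ) ≤ 2 * X}

/-- The law of a prime `P` drawn uniformly from `[X, 2X]`. -/
noncomputable def primeLaw (X : ℝ) : Measure ℕ :=
  uniformOn (dyadicPrimes X)

/-- Offset patterns `0 = h_0 < h_1 < ⋯ < h_m`. -/
def IsOffsetPattern {m : ℕ} (h : Fin (m + 1) → ℕ) : Prop :=
  h 0 = 0 ∧ StrictMono h

/-- The constellation event: `n + h_j` is prime for every `0 ≤ j ≤ m`. -/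
def Constellation {m : ℕ} (h : Fin (m + 1) → ℕ) (n : ℕ) : Prop :=
  ∀ j, (n + h j).Prime

/-- The number of distinct residue classes modulo `p` occupied by `h_0, …, h_m`. -/
def residueCount {m : ℕ} (h : Fin (m + 1) → ℕ) (p : ℕ) : ℕ :=
  (Finset.univ.image fun j => ((h j : ℕ) : ZMod p)).card

/-- The Euler factor at `p` of the singular series of the `(m + 1)`-tuple `h`. -/
noncomputable def singularFactor {m : ℕ} (h : Fin (m + 1) → ℕ) (p : Nat.Primes) : ℝ :=
  (1 - (residueCount h (p : ℕ) : ℝ) / ((p : ℕ) : ℝ)) /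
    (1 - 1 / ((p : ℕ) : ℝ)) ^ (m + 1)

/-- The singular series of the `(m + 1)`-tuple `h`, as an Euler product over all primes. -/
noncomputable def singularSeries {m : ℕ} (h : Fin (m + 1) → ℕ) : ℝ :=
  ∏' p : Nat.Primes, singularFactor h p

/-! A constellation at `n` avoids the classes `-h_j` modulo every prime `p ≤ z`, where `z` is a
small power of `X`, so Selberg's upper-bound sieve applies. Rankin's trick shows that the truncated
Selberg sum is at least half of the full Euler product, and Mertens' theorem turns that product into
`𝔖(h) / (log z) ^ (m + 1)`. One logarithm is lost to Chebyshev's lower bound for the number of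
primes in `[X, 2X]`. If the classes cover everything modulo some prime, then `𝔖(h) = 0` and no large
`n` carries a constellation; otherwise `𝔖(h)` is bounded below in terms of `m`, so the main term
absorbs the sieve remainder.

As for the size of `𝔖(h)`, an Euler factor exceeds `1` only at a prime dividing some difference
`h_j - h_i`, and then it is at most `(1 - 1 / p) ^ (-m)`. There are `O(log X)` such primes: by
Mertens' theorem those up to `log X` contribute `O((log log X) ^ m)`, and the others `O(1)`. -/

section SelbergSieve

open Finset BoundingSieve
open scoped ArithmeticFunction.Moebius

theorem sum_moebius_of_dvd_of_dvd {l m : ℕ} (hm : Squarefree m) (hl : l ∣ m) :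
    ∑ d ∈ m.divisors with l ∣ d, μ d = if l = m then μ l else 0 := by
  obtain ⟨k, rfl⟩ := hl
  have hl0 : l ≠ 0 := left_ne_zero_of_mul hm.ne_zero
  have hk0 : k ≠ 0 := right_ne_zero_of_mul hm.ne_zero
  have hmultiples : (l * k).divisors.filter (l ∣ ·) = k.divisors.image (l * ·) := by
    ext d
    simp only [mem_filter, Nat.mem_divisors, mem_image]
    constructor
    · rintro ⟨⟨hd, -⟩, e, rfl⟩
      exact ⟨e, ⟨Nat.dvd_of_mul_dvd_mul_left (Nat.pos_of_ne_zero hl0) hd, hk0⟩, rfl⟩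
    · rintro ⟨e, ⟨he, -⟩, rfl⟩
      exact ⟨⟨Nat.mul_dvd_mul_left l he, hm.ne_zero⟩, l.dvd_mul_right e⟩
  calc ∑ d ∈ (l * k).divisors with l ∣ d, μ d
      = ∑ e ∈ k.divisors, μ (l * e) := by
        rw [hmultiples, sum_image fun _ _ _ _ h => mul_left_cancel₀ hl0 h]
    _ = μ l * ∑ e ∈ k.divisors, μ e := by
        rw [mul_sum]
        refine sum_congr rfl fun e he => ?_
        have hle : l.Coprime e :=
          (Nat.coprime_of_squarefree_mul hm).coprime_dvd_right (Nat.dvd_of_mem_divisors he)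
        exact ArithmeticFunction.isMultiplicative_moebius.map_mul_of_coprime hle
    _ = if l = l * k then μ l else 0 := by
        rw [← ArithmeticFunction.coe_mul_zeta_apply, ArithmeticFunction.moebius_mul_coe_zeta,
          ArithmeticFunction.one_apply, mul_ite, mul_one, mul_zero]
        simp only [left_eq_mul₀ hl0]

/-- The sum of the terms `g(l)` of the Selberg sieve over the divisors `l ≤ y` of the sifting
product; its reciprocal is the minimum of the Selberg quadratic form. -/
noncomputable def selbergSum (s : BoundingSieve) (y : ℕ) : ℝ :=
  ∑ l ∈ s.prodPrimes.divisors with l ≤ y, s.selbergTerms l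

/-- Selberg's optimal `Λ²` weights, supported on the divisors `d ≤ y` of the sifting product. -/
noncomputable def selbergWeight (s : BoundingSieve) (y d : ℕ) : ℝ :=
  (s.nu d)⁻¹ * (μ d * (∑ l ∈ s.prodPrimes.divisors with d ∣ l ∧ l ≤ y, s.selbergTerms l) /
    selbergSum s y)

variable {s : BoundingSieve} {y : ℕ}

theorem selbergTerms_nonneg {l : ℕ} (hl : l ∈ s.prodPrimes.divisors) : 0 ≤ s.selbergTerms l :=
  (selbergTerms_pos (Nat.dvd_of_mem_divisors hl)).le

theorem selbergSum_pos (hy : 1 ≤ y) : 0 < selbergSum s y :=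
  sum_pos (fun _ hl => selbergTerms_pos (Nat.dvd_of_mem_divisors (mem_of_mem_filter _ hl)))
    ⟨1, by simp [hy, prodPrimes_ne_zero]⟩

theorem selbergWeight_one (hy : 1 ≤ y) : selbergWeight s y 1 = 1 := by
  have hS := (selbergSum_pos (s := s) hy).ne'
  simp only [selbergWeight, s.nu_mult.map_one, one_dvd, true_and, ← selbergSum.eq_1]
  simp [hS]

theorem selbergWeight_of_lt {d : ℕ} (hd : y < d) : selbergWeight s y d = 0 := by
  have hempty : s.prodPrimes.divisors.filter (fun l => d ∣ l ∧ l ≤ y) = ∅ := by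
    refine filter_false_of_mem fun l hl hdl => ?_
    exact (hd.trans_le (Nat.le_of_dvd (Nat.pos_of_mem_divisors hl) hdl.1)).not_ge hdl.2
  simp [selbergWeight, hempty]

theorem abs_selbergWeight_le (hy : 1 ≤ y) {d : ℕ} (hd : d ∣ s.prodPrimes) :
    |selbergWeight s y d| ≤ (s.nu d)⁻¹ := by
  have hS := selbergSum_pos (s := s) hy
  set T := ∑ l ∈ s.prodPrimes.divisors with d ∣ l ∧ l ≤ y, s.selbergTerms l with hT
  have hT0 : 0 ≤ T := sum_nonneg fun l hl => selbergTerms_nonneg (mem_of_mem_filter l hl)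
  have hTS : T ≤ selbergSum s y :=
    sum_le_sum_of_subset_of_nonneg (monotone_filter_right _ fun _ _ h => h.2)
      fun l hl _ => selbergTerms_nonneg (mem_of_mem_filter l hl)
  have hμ : |(μ d : ℝ)| ≤ 1 := mod_cast ArithmeticFunction.abs_moebius_le_one
  have hν : 0 < (s.nu d)⁻¹ := inv_pos.2 (nu_pos_of_dvd_prodPrimes hd)
  rw [selbergWeight, ← hT, abs_mul, abs_of_pos hν, abs_div, abs_mul, abs_of_pos hS,
    abs_of_nonneg hT0]
  refine mul_le_of_le_one_right hν.le ((div_le_one hS).2 ?_)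
  exact (mul_le_of_le_one_left hT0 hμ).trans hTS

/-- The weights diagonalise the quadratic form: this is the dual Möbius inversion. -/
theorem sum_nu_mul_selbergWeight {l : ℕ} (hl : l ∣ s.prodPrimes) :
    (∑ d ∈ s.prodPrimes.divisors, if l ∣ d then s.nu d * selbergWeight s y d else 0) =
      if l ≤ y then μ l * s.selbergTerms l / selbergSum s y else 0 := by
  have hinner (m : ℕ) (hm : m ∈ s.prodPrimes.divisors) :
      (∑ d ∈ s.prodPrimes.divisors with l ∣ d ∧ d ∣ m, (μ d : ℝ)) =
        if l = m then (μ l : ℝ) else 0 := by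
    have hdiv := Nat.divisors_filter_dvd_of_dvd (prodPrimes_ne_zero (s := s))
      (Nat.dvd_of_mem_divisors hm)
    by_cases hlm : l ∣ m
    · simp_rw [and_comm (a := l ∣ _)]
      rw [← filter_filter, hdiv]
      exact_mod_cast sum_moebius_of_dvd_of_dvd (squarefree_of_mem_divisors_prodPrimes hm) hlm
    · rw [filter_false_of_mem fun d _ h => hlm (h.1.trans h.2), sum_empty,
        if_neg fun h => hlm h.dvd]
  calc (∑ d ∈ s.prodPrimes.divisors, if l ∣ d then s.nu d * selbergWeight s y d else 0)
      = (∑ d ∈ s.prodPrimes.divisors with l ∣ d, ∑ m ∈ s.prodPrimes.divisors with d ∣ m ∧ m ≤ y,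
          μ d * s.selbergTerms m) / selbergSum s y := by
        rw [← sum_filter, sum_div]
        refine sum_congr rfl fun d hd => ?_
        have hν := nu_ne_zero (Nat.dvd_of_mem_divisors (mem_of_mem_filter d hd))
        rw [selbergWeight, mul_inv_cancel_left₀ hν, mul_sum]
    _ = (∑ m ∈ s.prodPrimes.divisors with m ≤ y,
          (∑ d ∈ s.prodPrimes.divisors with l ∣ d ∧ d ∣ m, (μ d : ℝ)) * s.selbergTerms m) /
            selbergSum s y := by
        congr 1
        simp_rw [sum_mul]
        refine sum_comm' fun d m => ?_
        simp only [mem_filter]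
        tauto
    _ = (∑ m ∈ s.prodPrimes.divisors with m ≤ y,
          if l = m then μ l * s.selbergTerms l else 0) / selbergSum s y := by
        congr 1
        refine sum_congr rfl fun m hm => ?_
        rw [hinner m (mem_of_mem_filter m hm), ite_mul, zero_mul]
        split_ifs with h
        · rw [h]
        · rfl
    _ = if l ≤ y then μ l * s.selbergTerms l / selbergSum s y else 0 := by
        simp [sum_ite_eq, hl, prodPrimes_ne_zero, ite_div]

theorem mainSum_lambdaSquared_selbergWeight :
    s.mainSum (lambdaSquared (selbergWeight s y)) = (selbergSum s y)⁻¹ := by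
  calc s.mainSum (lambdaSquared (selbergWeight s y))
      = ∑ l ∈ s.prodPrimes.divisors,
          if l ≤ y then s.selbergTerms l / selbergSum s y ^ 2 else 0 := by
        rw [mainSum_lambdaSquared_eq_sum_mul_sum_sq]
        refine sum_congr rfl fun l hl => ?_
        have hμ : (μ l : ℝ) ^ 2 = 1 := mod_cast
          ArithmeticFunction.moebius_sq_eq_one_of_squarefree
            (squarefree_of_mem_divisors_prodPrimes hl)
        rw [sum_nu_mul_selbergWeight (Nat.dvd_of_mem_divisors hl)]
        split_ifs
        · rw [div_pow, mul_pow, hμ]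
          field_simp
        · simp
    _ = (selbergSum s y)⁻¹ := by
        rw [← sum_filter, ← sum_div, ← selbergSum]
        field_simp

theorem errSum_lambdaSquared_le (w : ℕ → ℝ) :
    s.errSum (lambdaSquared w) ≤ ∑ d₁ ∈ s.prodPrimes.divisors, ∑ d₂ ∈ s.prodPrimes.divisors,
      |w d₁| * |w d₂| * |s.rem (d₁.lcm d₂)| := by
  have habs (d : ℕ) (hd : d ∈ s.prodPrimes.divisors) :
      |lambdaSquared w d| ≤ ∑ d₁ ∈ s.prodPrimes.divisors, ∑ d₂ ∈ s.prodPrimes.divisors,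
        if d = d₁.lcm d₂ then |w d₁| * |w d₂| else 0 := by
    have hsub := Nat.divisors_subset_of_dvd (prodPrimes_ne_zero (s := s))
      (Nat.dvd_of_mem_divisors hd)
    have hnonneg (d₁ d₂ : ℕ) : 0 ≤ if d = d₁.lcm d₂ then |w d₁| * |w d₂| else 0 := by positivity
    calc |lambdaSquared w d|
        ≤ ∑ d₁ ∈ d.divisors, ∑ d₂ ∈ d.divisors, |if d = d₁.lcm d₂ then w d₁ * w d₂ else 0| :=
          (abs_sum_le_sum_abs _ _).trans (sum_le_sum fun _ _ => abs_sum_le_sum_abs _ _)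
      _ = ∑ d₁ ∈ d.divisors, ∑ d₂ ∈ d.divisors, if d = d₁.lcm d₂ then |w d₁| * |w d₂| else 0 := by
          simp only [apply_ite abs, abs_mul, abs_zero]
      _ ≤ _ := (sum_le_sum fun _ _ =>
            sum_le_sum_of_subset_of_nonneg hsub fun _ _ _ => hnonneg _ _).trans
          (sum_le_sum_of_subset_of_nonneg hsub fun _ _ _ => sum_nonneg fun _ _ => hnonneg _ _)
  calc s.errSum (lambdaSquared w)
      ≤ ∑ d ∈ s.prodPrimes.divisors, (∑ d₁ ∈ s.prodPrimes.divisors, ∑ d₂ ∈ s.prodPrimes.divisors,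
          if d = d₁.lcm d₂ then |w d₁| * |w d₂| else 0) * |s.rem d| :=
        sum_le_sum fun d hd => mul_le_mul_of_nonneg_right (habs d hd) (abs_nonneg _)
    _ = ∑ d₁ ∈ s.prodPrimes.divisors, ∑ d₂ ∈ s.prodPrimes.divisors, ∑ d ∈ s.prodPrimes.divisors,
          if d = d₁.lcm d₂ then |w d₁| * |w d₂| * |s.rem d| else 0 := by
        simp_rw [sum_mul, ite_mul, zero_mul]
        rw [sum_comm]
        exact sum_congr rfl fun _ _ => sum_comm
    _ = _ := by
        refine sum_congr rfl fun d₁ h₁ => sum_congr rfl fun d₂ h₂ => ?_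
        have hlcm : d₁.lcm d₂ ∈ s.prodPrimes.divisors := Nat.mem_divisors.2
          ⟨Nat.lcm_dvd (Nat.dvd_of_mem_divisors h₁) (Nat.dvd_of_mem_divisors h₂),
            prodPrimes_ne_zero⟩
        rw [sum_ite_eq', if_pos hlcm]

theorem errSum_lambdaSquared_le_sq (w : ℕ → ℝ) (hrem : ∀ d, d ∣ s.prodPrimes → |s.rem d| ≤ d) :
    s.errSum (lambdaSquared w) ≤ (∑ d ∈ s.prodPrimes.divisors, |w d| * d) ^ 2 := by
  refine (errSum_lambdaSquared_le w).trans ?_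
  rw [sq, sum_mul_sum]
  refine sum_le_sum fun d₁ h₁ => sum_le_sum fun d₂ h₂ => ?_
  have hlcm : |s.rem (d₁.lcm d₂)| ≤ d₁ * d₂ :=
    (hrem _ (Nat.lcm_dvd (Nat.dvd_of_mem_divisors h₁) (Nat.dvd_of_mem_divisors h₂))).trans
      (mod_cast Nat.lcm_le_mul (Nat.pos_of_mem_divisors h₁) (Nat.pos_of_mem_divisors h₂))
  rw [mul_mul_mul_comm]
  gcongr

theorem sum_abs_selbergWeight_mul_le (hy : 1 ≤ y)
    (hν : ∀ d, d ∣ s.prodPrimes → (d : ℝ)⁻¹ ≤ s.nu d) :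
    ∑ d ∈ s.prodPrimes.divisors, |selbergWeight s y d| * d ≤ (y : ℝ) ^ 3 := by
  have hweight (d : ℕ) (hd : d ∈ s.prodPrimes.divisors) : |selbergWeight s y d| ≤ d := by
    have hd' := Nat.dvd_of_mem_divisors hd
    have hd0 : (0 : ℝ) < d := mod_cast Nat.pos_of_mem_divisors hd
    exact (abs_selbergWeight_le hy hd').trans (inv_le_of_inv_le₀ hd0 (hν d hd'))
  have hcard : (#{d ∈ s.prodPrimes.divisors | d ≤ y} : ℝ) ≤ y := by
    have hsub : {d ∈ s.prodPrimes.divisors | d ≤ y} ⊆ Icc 1 y := fun d hd => by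
      obtain ⟨hd, hdy⟩ := mem_filter.1 hd
      exact mem_Icc.2 ⟨Nat.pos_of_mem_divisors hd, hdy⟩
    exact_mod_cast (card_le_card hsub).trans_eq (by simp)
  calc ∑ d ∈ s.prodPrimes.divisors, |selbergWeight s y d| * d
      = ∑ d ∈ s.prodPrimes.divisors with d ≤ y, |selbergWeight s y d| * d := by
        refine (sum_filter_of_ne fun d _ hne => not_lt.1 fun hlt => hne ?_).symm
        rw [selbergWeight_of_lt hlt, abs_zero, zero_mul]
    _ ≤ #{d ∈ s.prodPrimes.divisors | d ≤ y} • ((y : ℝ) * y) := by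
        refine sum_le_card_nsmul _ _ _ fun d hd => ?_
        obtain ⟨hd, hdy⟩ := mem_filter.1 hd
        have hdy : (d : ℝ) ≤ y := mod_cast hdy
        exact mul_le_mul ((hweight d hd).trans hdy) hdy d.cast_nonneg y.cast_nonneg
    _ ≤ y * ((y : ℝ) * y) := by
        rw [nsmul_eq_mul]
        gcongr
    _ = (y : ℝ) ^ 3 := by ring

theorem errSum_selbergWeight_le (hy : 1 ≤ y) (hν : ∀ d, d ∣ s.prodPrimes → (d : ℝ)⁻¹ ≤ s.nu d)
    (hrem : ∀ d, d ∣ s.prodPrimes → |s.rem d| ≤ d) :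
    s.errSum (lambdaSquared (selbergWeight s y)) ≤ (y : ℝ) ^ 6 :=
  calc s.errSum (lambdaSquared (selbergWeight s y))
      ≤ (∑ d ∈ s.prodPrimes.divisors, |selbergWeight s y d| * d) ^ 2 :=
        errSum_lambdaSquared_le_sq _ hrem
    _ ≤ ((y : ℝ) ^ 3) ^ 2 := by
        gcongr
        exact sum_abs_selbergWeight_mul_le hy hν
    _ = (y : ℝ) ^ 6 := by ring

theorem siftedSum_le_totalMass_div_selbergSum_add (hy : 1 ≤ y)
    (hν : ∀ d, d ∣ s.prodPrimes → (d : ℝ)⁻¹ ≤ s.nu d)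
    (hrem : ∀ d, d ∣ s.prodPrimes → |s.rem d| ≤ d) :
    s.siftedSum ≤ s.totalMass / selbergSum s y + (y : ℝ) ^ 6 := by
  have hΛ := upperMoebius_lambdaSquared (selbergWeight s y) (selbergWeight_one hy)
  calc s.siftedSum
      ≤ s.totalMass * s.mainSum (lambdaSquared (selbergWeight s y)) +
          s.errSum (lambdaSquared (selbergWeight s y)) :=
        siftedSum_le_mainSum_errSum_of_upperMoebius _ hΛ
    _ ≤ s.totalMass / selbergSum s y + (y : ℝ) ^ 6 := by
        rw [mainSum_lambdaSquared_selbergWeight, ← div_eq_mul_inv]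
        gcongr
        exact errSum_selbergWeight_le hy hν hrem

end SelbergSieve

section Mertens

open Finset Nat

theorem prod_primesLE_pow_div_dvd_factorial (z : ℕ) : ∏ p ∈ primesLE z, p ^ (z / p) ∣ z ! := by
  refine prod_dvd_of_isRelPrime (fun p hp q hq hpq => ?_) fun p hp => ?_
  · have hcop := (coprime_primes (prime_of_mem_primesLE hp) (prime_of_mem_primesLE hq)).2 hpq
    exact coprime_iff_isRelPrime.1 (hcop.pow _ _)
  · rw [(prime_of_mem_primesLE hp).pow_dvd_factorial_iff (b := Nat.log p z + 2) (by omega)]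
    calc z / p = z / p ^ 1 := by rw [pow_one]
      _ ≤ ∑ i ∈ Ico 1 (Nat.log p z + 2), z / p ^ i :=
        single_le_sum (f := fun i => z / p ^ i) (fun _ _ => Nat.zero_le _)
          (mem_Ico.2 ⟨le_rfl, by omega⟩)

theorem sum_primesLE_div_mul_log_le (z : ℕ) :
    ∑ p ∈ primesLE z, (z / p : ℕ) * Real.log p ≤ z * Real.log z := by
  have hpos : ∀ p ∈ primesLE z, 0 < p ^ (z / p) :=
    fun p hp => pow_pos (prime_of_mem_primesLE hp).pos _
  have hle : ∏ p ∈ primesLE z, p ^ (z / p) ≤ z ^ z :=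
    (le_of_dvd z.factorial_pos (prod_primesLE_pow_div_dvd_factorial z)).trans z.factorial_le_pow
  calc ∑ p ∈ primesLE z, (z / p : ℕ) * Real.log p
      = Real.log (∏ p ∈ primesLE z, p ^ (z / p) : ℕ) := by
        rw [cast_prod, Real.log_prod fun p hp => cast_ne_zero.2 (hpos p hp).ne']
        simp only [cast_pow, Real.log_pow]
    _ ≤ Real.log ((z : ℝ) ^ z) :=
        Real.log_le_log (cast_pos.2 (prod_pos hpos)) (mod_cast hle)
    _ = z * Real.log z := Real.log_pow z z

theorem sum_primesLE_log_div_le {z : ℕ} (hz : 1 ≤ z) :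
    ∑ p ∈ primesLE z, Real.log p / p ≤ Real.log z + Real.log 4 := by
  have hterm : ∀ p ∈ primesLE z,
      z * (Real.log p / p) ≤ (z / p : ℕ) * Real.log p + Real.log p := by
    intro p _
    have hfloor : (z : ℝ) / p ≤ (z / p : ℕ) + 1 := by
      rw [← floor_div_eq_div (K := ℝ)]
      exact (lt_floor_add_one _).le
    calc z * (Real.log p / p) = z / p * Real.log p := by ring
      _ ≤ ((z / p : ℕ) + 1) * Real.log p := by
        gcongr
      _ = (z / p : ℕ) * Real.log p + Real.log p := by ring
  have hθ : ∑ p ∈ primesLE z, Real.log p ≤ Real.log 4 * z := by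
    rw [← Chebyshev.theta_eq_sum_primesLE_log]
    exact Chebyshev.theta_le_log4_mul_x z.cast_nonneg
  refine le_of_mul_le_mul_left ?_ (show (0 : ℝ) < z from mod_cast hz)
  calc z * ∑ p ∈ primesLE z, Real.log p / p
      ≤ ∑ p ∈ primesLE z, (z / p : ℕ) * Real.log p + ∑ p ∈ primesLE z, Real.log p := by
        rw [mul_sum, ← sum_add_distrib]
        exact sum_le_sum hterm
    _ ≤ z * Real.log z + Real.log 4 * z := add_le_add (sum_primesLE_div_mul_log_le z) hθ
    _ = z * (Real.log z + Real.log 4) := by ring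

theorem sum_primesLE_log_div_le_three_mul_log {z : ℕ} (hz : 2 ≤ z) :
    ∑ p ∈ primesLE z, Real.log p / p ≤ 3 * Real.log z := by
  have hlog4 : Real.log 4 = 2 * Real.log 2 := by
    rw [show (4 : ℝ) = 2 ^ 2 by norm_num, Real.log_pow, cast_two]
  have hlog2 : Real.log 2 ≤ Real.log z := Real.log_le_log two_pos (mod_cast hz)
  linarith [sum_primesLE_log_div_le (one_le_two.trans hz)]

theorem hasSum_smoothNumbers_rpow_neg {σ : ℝ} (hσ : 0 < σ) (z : ℕ) :
    HasSum (fun n : smoothNumbers (z + 1) => (n : ℝ) ^ (-σ))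
      (∏ p ∈ primesLE z, (1 - (p : ℝ) ^ (-σ))⁻¹) := by
  let f : ℕ →* ℝ :=
    { toFun := fun n => (n : ℝ) ^ (-σ)
      map_one' := by simp
      map_mul' := fun a b => by rw [cast_mul, Real.mul_rpow a.cast_nonneg b.cast_nonneg] }
  refine (EulerProduct.summable_and_hasSum_smoothNumbers_prod_primesBelow_geometric (f := f)
    (fun {p} hp => ?_) (z + 1)).2
  have hp1 : (1 : ℝ) < p := mod_cast hp.one_lt
  have hfp : f p = (p : ℝ) ^ (-σ) := rfl
  rw [hfp, Real.norm_of_nonneg (by positivity)]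
  exact Real.rpow_lt_one_of_one_lt_of_neg hp1 (neg_neg_of_pos hσ)

theorem log_le_prod_primesLE_inv_one_sub_inv (z : ℕ) :
    Real.log z ≤ ∏ p ∈ primesLE z, (1 - 1 / (p : ℝ))⁻¹ := by
  rcases Nat.eq_zero_or_pos z with rfl | hz
  · simp
  have hsmooth : ∀ n ∈ Icc 1 z, n ∈ smoothNumbers (z + 1) := by
    intro n hn
    obtain ⟨hn1, hnz⟩ := mem_Icc.1 hn
    rw [mem_smoothNumbers']
    exact fun p _ hpn => Nat.lt_succ_of_le ((le_of_dvd hn1 hpn).trans hnz)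
  have hsum := hasSum_smoothNumbers_rpow_neg one_pos z
  calc Real.log z
      ≤ Real.log ((z + 1 : ℕ) : ℝ) := Real.log_le_log (mod_cast hz) (mod_cast z.le_succ)
    _ ≤ harmonic z := log_add_one_le_harmonic z
    _ = ∑ n ∈ Icc 1 z, (n : ℝ) ^ (-1 : ℝ) := by
        simp [harmonic_eq_sum_Icc, Real.rpow_neg_one]
    _ = ∑ n ∈ (Icc 1 z).subtype (· ∈ smoothNumbers (z + 1)), ((n : ℕ) : ℝ) ^ (-1 : ℝ) :=
        (sum_subtype_of_mem (fun n : ℕ => (n : ℝ) ^ (-1 : ℝ)) hsmooth).symm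
    _ ≤ ∏ p ∈ primesLE z, (1 - (p : ℝ) ^ (-1 : ℝ))⁻¹ :=
        sum_le_hasSum _ (fun n _ => by positivity) hsum
    _ = ∏ p ∈ primesLE z, (1 - 1 / (p : ℝ))⁻¹ := by
        simp only [Real.rpow_neg_one, one_div]

theorem tsum_nat_rpow_neg_le {σ : ℝ} (hσ : 1 < σ) :
    ∑' n : ℕ, (n : ℝ) ^ (-σ) ≤ 1 + 1 / (σ - 1) := by
  have hsummable : Summable fun n : ℕ => (n : ℝ) ^ (-σ) := by
    rw [Real.summable_nat_rpow]
    linarith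
  have hzeta := ZetaAsymptotics.zeta_limit_aux1 hσ
  have hterm : 0 ≤ ZetaAsymptotics.termTSum σ :=
    tsum_nonneg fun n => ZetaAsymptotics.term_nonneg _ σ
  have hzero : (0 : ℝ) ^ (-σ) = 0 := Real.zero_rpow (by linarith)
  have hshift : ∑' n : ℕ, (n : ℝ) ^ (-σ) = ∑' n : ℕ, 1 / (n + 1 : ℝ) ^ σ := by
    rw [hsummable.tsum_eq_zero_add, cast_zero, hzero, zero_add]
    refine tsum_congr fun n => ?_
    rw [cast_add_one, Real.rpow_neg (by positivity), one_div]
  rw [hshift]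
  nlinarith

theorem prod_primesLE_inv_one_sub_rpow_neg_le {σ : ℝ} (hσ : 1 < σ) (z : ℕ) :
    ∏ p ∈ primesLE z, (1 - (p : ℝ) ^ (-σ))⁻¹ ≤ 1 + 1 / (σ - 1) := by
  have hsummable : Summable fun n : ℕ => (n : ℝ) ^ (-σ) := by
    rw [Real.summable_nat_rpow]
    linarith
  rw [← (hasSum_smoothNumbers_rpow_neg (one_pos.trans hσ) z).tsum_eq]
  exact (hsummable.tsum_subtype_le _ _ fun n => by positivity).trans (tsum_nat_rpow_neg_le hσ)

theorem one_sub_inv_pos {p : ℕ} (hp : 2 ≤ p) : 0 < 1 - 1 / (p : ℝ) := by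
  have hp' : (2 : ℝ) ≤ p := mod_cast hp
  rw [sub_pos, div_lt_one] <;> linarith

theorem one_sub_rpow_neg_le {p : ℕ} (hp : 2 ≤ p) {δ : ℝ} (hδ : 0 ≤ δ) :
    1 - (p : ℝ) ^ (-(1 + δ)) ≤ (1 - 1 / (p : ℝ)) * Real.exp (2 * δ * (Real.log p / p)) := by
  have hp2 : (2 : ℝ) ≤ p := mod_cast hp
  have hp0 : (0 : ℝ) < p := by linarith
  have hlog : 0 ≤ Real.log p := Real.log_natCast_nonneg p
  have hrpow : 1 / (p : ℝ) * (1 - δ * Real.log p) ≤ (p : ℝ) ^ (-(1 + δ)) := by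
    rw [neg_add, Real.rpow_add hp0, Real.rpow_neg_one, one_div, Real.rpow_def_of_pos hp0]
    gcongr
    linarith [Real.add_one_le_exp (Real.log p * -δ)]
  calc 1 - (p : ℝ) ^ (-(1 + δ))
      ≤ 1 - 1 / p + δ * (Real.log p / p) := by
        rw [mul_sub, mul_one] at hrpow
        linarith [show 1 / (p : ℝ) * (δ * Real.log p) = δ * (Real.log p / p) by ring]
    _ ≤ (1 - 1 / p) * (2 * δ * (Real.log p / p) + 1) := by
        have hhalf : 1 / (p : ℝ) ≤ 1 / 2 := one_div_le_one_div_of_le two_pos hp2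
        nlinarith [mul_nonneg hδ (div_nonneg hlog hp0.le)]
    _ ≤ (1 - 1 / p) * Real.exp (2 * δ * (Real.log p / p)) :=
        mul_le_mul_of_nonneg_left (Real.add_one_le_exp _) (one_sub_inv_pos hp).le

theorem prod_primesLE_inv_one_sub_inv_le {z : ℕ} (hz : 2 ≤ z) :
    ∏ p ∈ primesLE z, (1 - 1 / (p : ℝ))⁻¹ ≤ Real.exp 6 * (1 + Real.log z) := by
  have hlog : 0 < Real.log z := Real.log_pos (mod_cast hz)
  set δ := 1 / Real.log z with hδ
  have hδ0 : 0 < δ := one_div_pos.2 hlog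
  have hpos (p : ℕ) (hp : p ∈ primesLE z) : 0 < 1 - (p : ℝ) ^ (-(1 + δ)) := by
    have hp1 : (1 : ℝ) < p := mod_cast one_lt_of_mem_primesLE hp
    exact sub_pos.2 (Real.rpow_lt_one_of_one_lt_of_neg hp1 (by linarith))
  have hfactor (p : ℕ) (hp : p ∈ primesLE z) :
      (1 - 1 / (p : ℝ))⁻¹ ≤
        (1 - (p : ℝ) ^ (-(1 + δ)))⁻¹ * Real.exp (2 * δ * (Real.log p / p)) := by
    have hp2 := two_le_of_mem_primesLE hp
    rw [inv_mul_eq_div, le_div_iff₀ (hpos p hp), inv_mul_le_iff₀ (one_sub_inv_pos hp2)]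
    exact one_sub_rpow_neg_le hp2 hδ0.le
  calc ∏ p ∈ primesLE z, (1 - 1 / (p : ℝ))⁻¹
      ≤ ∏ p ∈ primesLE z,
          (1 - (p : ℝ) ^ (-(1 + δ)))⁻¹ * Real.exp (2 * δ * (Real.log p / p)) :=
        prod_le_prod (fun p hp => (inv_pos.2 (one_sub_inv_pos (two_le_of_mem_primesLE hp))).le)
          hfactor
    _ = (∏ p ∈ primesLE z, (1 - (p : ℝ) ^ (-(1 + δ)))⁻¹) *
          Real.exp (2 * δ * ∑ p ∈ primesLE z, Real.log p / p) := by
        rw [prod_mul_distrib, ← Real.exp_sum, ← mul_sum]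
    _ ≤ (1 + 1 / δ) * Real.exp (2 * δ * (3 * Real.log z)) := by
        gcongr
        · simpa only [add_sub_cancel_left] using
            prod_primesLE_inv_one_sub_rpow_neg_le (lt_add_of_pos_right 1 hδ0) z
        · exact sum_primesLE_log_div_le_three_mul_log hz
    _ = Real.exp 6 * (1 + Real.log z) := by
        rw [hδ, one_div_one_div, mul_comm]
        congr 2
        field_simp
        norm_num

end Mertens

section Rankin

open Finset BoundingSieve

theorem sum_divisors_prod_primeFactors {R : Type*} [CommSemiring R] {n : ℕ} (hn : Squarefree n)
    (f : ℕ → R) :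
    ∑ d ∈ n.divisors, ∏ p ∈ d.primeFactors, f p = ∏ p ∈ n.primeFactors, (1 + f p) := by
  have hmul :=
    (ArithmeticFunction.IsMultiplicative.prodPrimeFactors f).prodPrimeFactors_one_add_of_squarefree
      hn
  rw [prod_congr rfl fun p hp => ?_, hmul]
  · refine sum_congr rfl fun d hd => ?_
    rw [ArithmeticFunction.prodPrimeFactors_apply (Nat.pos_of_mem_divisors hd).ne']
  · have hp' := Nat.prime_of_mem_primeFactors hp
    rw [ArithmeticFunction.prodPrimeFactors_apply hp'.ne_zero, hp'.primeFactors, prod_singleton]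

theorem one_add_div_one_sub_mul_exp_le {ν u : ℝ} (hν0 : 0 ≤ ν) (hν1 : ν < 1) (hu0 : 0 ≤ u)
    (hu1 : u ≤ 1) :
    1 + ν / (1 - ν) * Real.exp u ≤ (1 - ν)⁻¹ * Real.exp (2 * (ν * u)) := by
  have hsub : 0 < 1 - ν := sub_pos.2 hν1
  have hexp : Real.exp u - 1 ≤ 2 * u := by
    have hquad := (abs_le.1 (Real.abs_exp_sub_one_sub_id_le (abs_le.2 ⟨by linarith, hu1⟩))).2
    nlinarith
  calc 1 + ν / (1 - ν) * Real.exp u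
      = (1 - ν)⁻¹ * (ν * (Real.exp u - 1) + 1) := by
        field_simp
        ring
    _ ≤ (1 - ν)⁻¹ * (2 * (ν * u) + 1) := by
        gcongr ?_ * (?_ + 1)
        linarith [mul_le_mul_of_nonneg_left hexp hν0]
    _ ≤ (1 - ν)⁻¹ * Real.exp (2 * (ν * u)) := by
        gcongr
        exact Real.add_one_le_exp _

variable {s : BoundingSieve} {k z : ℕ}

theorem selbergTerms_eq_prod_primeFactors {d : ℕ} (hd : d ∣ s.prodPrimes) :
    s.selbergTerms d = ∏ p ∈ d.primeFactors, s.nu p / (1 - s.nu p) := by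
  rw [selbergTerms_apply, ← prod_primeFactors_nu hd, ← prod_mul_distrib]
  simp only [div_eq_mul_inv]

theorem sum_selbergTerms (s : BoundingSieve) :
    ∑ d ∈ s.prodPrimes.divisors, s.selbergTerms d =
      ∏ p ∈ s.prodPrimes.primeFactors, (1 - s.nu p)⁻¹ := by
  rw [sum_congr rfl fun d hd => selbergTerms_eq_prod_primeFactors (Nat.dvd_of_mem_divisors hd),
    sum_divisors_prod_primeFactors s.prodPrimes_squarefree]
  refine prod_congr rfl fun p hp => ?_
  have hsub : 0 < 1 - s.nu p := sub_pos.2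
    (s.nu_lt_one_of_prime p (Nat.prime_of_mem_primeFactors hp) (Nat.dvd_of_mem_primeFactors hp))
  field_simp
  ring

theorem selbergTerms_mul_exp_log_div {d : ℕ} (hd : d ∣ s.prodPrimes) (t : ℝ) :
    s.selbergTerms d * Real.exp (Real.log d / t) =
      ∏ p ∈ d.primeFactors, s.nu p / (1 - s.nu p) * Real.exp (Real.log p / t) := by
  have hprod := Nat.prod_primeFactors_of_squarefree (squarefree_of_dvd_prodPrimes hd)
  rw [prod_mul_distrib, ← selbergTerms_eq_prod_primeFactors hd, ← Real.exp_sum, ← sum_div,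
    ← Real.log_prod, ← Nat.cast_prod, hprod]
  exact fun p hp => Nat.cast_ne_zero.2 (Nat.pos_of_mem_primeFactors hp).ne'

theorem sum_primeFactors_mul_log_le {n : ℕ} {ν : ℕ → ℝ} (hz : 2 ≤ z)
    (hsmooth : ∀ p ∈ n.primeFactors, p ≤ z) (hν : ∀ p ∈ n.primeFactors, ν p ≤ k / p) :
    ∑ p ∈ n.primeFactors, ν p * Real.log p ≤ 3 * k * Real.log z := by
  have hsub : n.primeFactors ⊆ Nat.primesLE z := fun p hp =>
    Nat.mem_primesLE.2 ⟨hsmooth p hp, Nat.prime_of_mem_primeFactors hp⟩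
  calc ∑ p ∈ n.primeFactors, ν p * Real.log p
      ≤ ∑ p ∈ n.primeFactors, k * (Real.log p / p) := by
        refine sum_le_sum fun p hp => ?_
        rw [← mul_comm_div]
        exact mul_le_mul_of_nonneg_right (hν p hp) (Real.log_natCast_nonneg p)
    _ ≤ k * ∑ p ∈ Nat.primesLE z, Real.log p / p := by
        rw [← mul_sum]
        gcongr
    _ ≤ k * (3 * Real.log z) := by
        gcongr
        exact sum_primesLE_log_div_le_three_mul_log hz
    _ = 3 * k * Real.log z := by ring

/-- Rankin's trick with the exponent `1 / log z`: writing `d ^ (1 / log z)` as a product over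
`p ∣ d` makes the weighted sum an Euler product. -/
theorem sum_selbergTerms_mul_exp_le (hz : 2 ≤ z) (hsmooth : ∀ p ∈ s.prodPrimes.primeFactors, p ≤ z)
    (hν : ∀ p ∈ s.prodPrimes.primeFactors, s.nu p ≤ k / p) :
    ∑ d ∈ s.prodPrimes.divisors, s.selbergTerms d * Real.exp (Real.log d / Real.log z) ≤
      Real.exp (6 * k) * ∏ p ∈ s.prodPrimes.primeFactors, (1 - s.nu p)⁻¹ := by
  have hlogz : 0 < Real.log z := Real.log_pos (mod_cast hz)
  have hfactor (p) (hp : p ∈ s.prodPrimes.primeFactors) :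
      0 ≤ s.nu p ∧ s.nu p < 1 ∧ 0 ≤ Real.log p / Real.log z ∧ Real.log p / Real.log z ≤ 1 := by
    obtain ⟨hp', hpP, -⟩ := Nat.mem_primeFactors.1 hp
    exact ⟨(s.nu_pos_of_prime p hp' hpP).le, s.nu_lt_one_of_prime p hp' hpP,
      div_nonneg (Real.log_natCast_nonneg p) hlogz.le,
      (div_le_one hlogz).2 (Real.log_le_log (mod_cast hp'.pos) (mod_cast hsmooth p hp))⟩
  have hexponent : ∑ p ∈ s.prodPrimes.primeFactors, 2 * (s.nu p * (Real.log p / Real.log z)) ≤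
      6 * k := by
    simp only [← mul_sum, ← mul_div_assoc, ← sum_div]
    rw [div_le_iff₀ hlogz]
    linarith [sum_primeFactors_mul_log_le hz hsmooth hν]
  calc ∑ d ∈ s.prodPrimes.divisors, s.selbergTerms d * Real.exp (Real.log d / Real.log z)
      = ∏ p ∈ s.prodPrimes.primeFactors,
          (1 + s.nu p / (1 - s.nu p) * Real.exp (Real.log p / Real.log z)) := by
        rw [← sum_divisors_prod_primeFactors s.prodPrimes_squarefree]
        exact sum_congr rfl fun d hd =>
          selbergTerms_mul_exp_log_div (Nat.dvd_of_mem_divisors hd) _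
    _ ≤ ∏ p ∈ s.prodPrimes.primeFactors,
          (1 - s.nu p)⁻¹ * Real.exp (2 * (s.nu p * (Real.log p / Real.log z))) := by
        refine prod_le_prod (fun p hp => ?_) fun p hp => ?_ <;>
          obtain ⟨hν0, hν1, hlog0, hlog1⟩ := hfactor p hp
        · have := div_nonneg hν0 (sub_pos.2 hν1).le
          positivity
        · exact one_add_div_one_sub_mul_exp_le hν0 hν1 hlog0 hlog1
    _ ≤ Real.exp (6 * k) * ∏ p ∈ s.prodPrimes.primeFactors, (1 - s.nu p)⁻¹ := by
        rw [prod_mul_distrib, ← Real.exp_sum, mul_comm]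
        gcongr
        exact prod_nonneg fun p hp => (inv_pos.2 (sub_pos.2 (hfactor p hp).2.1)).le

theorem selbergTerms_le_exp_mul_of_pow_lt (hz : 2 ≤ z) {d r : ℕ} (hd : d ∈ s.prodPrimes.divisors)
    (hzd : z ^ r < d) :
    s.selbergTerms d ≤
      Real.exp (-r) * (s.selbergTerms d * Real.exp (Real.log d / Real.log z)) := by
  have hlogz : 0 < Real.log z := Real.log_pos (mod_cast hz)
  have hlogd : r * Real.log z ≤ Real.log d := by
    rw [← Real.log_pow]
    exact Real.log_le_log (by positivity) (mod_cast hzd.le)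
  rw [mul_left_comm, ← Real.exp_add]
  refine le_mul_of_one_le_right (selbergTerms_nonneg hd) (Real.one_le_exp ?_)
  linarith [(le_div_iff₀ hlogz).2 hlogd]

theorem sum_selbergTerms_not_le_le_half_prod (hz : 2 ≤ z)
    (hsmooth : ∀ p ∈ s.prodPrimes.primeFactors, p ≤ z)
    (hν : ∀ p ∈ s.prodPrimes.primeFactors, s.nu p ≤ k / p) :
    ∑ d ∈ s.prodPrimes.divisors with ¬ d ≤ z ^ (6 * k + 1), s.selbergTerms d ≤
      1 / 2 * ∏ p ∈ s.prodPrimes.primeFactors, (1 - s.nu p)⁻¹ := by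
  have hprod : 0 ≤ ∏ p ∈ s.prodPrimes.primeFactors, (1 - s.nu p)⁻¹ :=
    (sum_nonneg fun d hd => selbergTerms_nonneg hd).trans_eq (sum_selbergTerms s)
  calc ∑ d ∈ s.prodPrimes.divisors with ¬ d ≤ z ^ (6 * k + 1), s.selbergTerms d
      ≤ ∑ d ∈ s.prodPrimes.divisors with ¬ d ≤ z ^ (6 * k + 1), Real.exp (-↑(6 * k + 1)) *
          (s.selbergTerms d * Real.exp (Real.log d / Real.log z)) :=
        sum_le_sum fun d hd => selbergTerms_le_exp_mul_of_pow_lt hz (mem_filter.1 hd).1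
          (not_le.1 (mem_filter.1 hd).2)
    _ ≤ Real.exp (-↑(6 * k + 1)) * ∑ d ∈ s.prodPrimes.divisors,
          s.selbergTerms d * Real.exp (Real.log d / Real.log z) := by
        rw [← mul_sum]
        gcongr
        · exact fun d hd _ => mul_nonneg (selbergTerms_nonneg hd) (Real.exp_pos _).le
        · exact filter_subset _ _
    _ ≤ Real.exp (-↑(6 * k + 1)) *
          (Real.exp (6 * k) * ∏ p ∈ s.prodPrimes.primeFactors, (1 - s.nu p)⁻¹) := by
        gcongr
        exact sum_selbergTerms_mul_exp_le hz hsmooth hν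
    _ = Real.exp (-1) * ∏ p ∈ s.prodPrimes.primeFactors, (1 - s.nu p)⁻¹ := by
        rw [← mul_assoc, ← Real.exp_add]
        congr 2
        push_cast
        ring
    _ ≤ 1 / 2 * ∏ p ∈ s.prodPrimes.primeFactors, (1 - s.nu p)⁻¹ := by
        gcongr
        linarith [Real.exp_neg_one_lt_half]

theorem half_prod_le_selbergSum (hz : 2 ≤ z) (hsmooth : ∀ p ∈ s.prodPrimes.primeFactors, p ≤ z)
    (hν : ∀ p ∈ s.prodPrimes.primeFactors, s.nu p ≤ k / p) :
    1 / 2 * ∏ p ∈ s.prodPrimes.primeFactors, (1 - s.nu p)⁻¹ ≤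
      selbergSum s (z ^ (6 * k + 1)) := by
  have hsplit := sum_filter_add_sum_filter_not s.prodPrimes.divisors
    (fun d => d ≤ z ^ (6 * k + 1)) fun d => s.selbergTerms d
  rw [sum_selbergTerms, ← selbergSum] at hsplit
  linarith [sum_selbergTerms_not_le_le_half_prod hz hsmooth hν]

end Rankin

section CongruenceConditions

open Finset

theorem card_filter_Ico_mul_of_periodic (P : ℕ → Prop) [DecidablePred P] {M : ℕ}
    (hP : Function.Periodic P M) (a q : ℕ) :
    #{n ∈ Ico a (a + q * M) | P n} = q * M.count P := by
  induction q with
  | zero => simp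
  | succ q ih =>
    rw [add_one_mul, ← add_assoc, ← Ico_union_Ico_eq_Ico (Nat.le_add_right a (q * M))
      (Nat.le_add_right _ M), filter_union, card_union_of_disjoint
      (disjoint_filter_filter (Ico_disjoint_Ico_consecutive _ _ _)), ih,
      Nat.filter_Ico_card_eq_of_periodic _ _ P hP, add_one_mul]

theorem abs_card_filter_Ico_sub_le (P : ℕ → Prop) [DecidablePred P] {M : ℕ} (hM : 0 < M)
    (hP : Function.Periodic P M) (a N : ℕ) :
    |(#{n ∈ Ico a (a + N) | P n} : ℝ) - N * (M.count P / M)| ≤ M := by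
  have hmono {K L : ℕ} (hKL : K ≤ L) :
      #{n ∈ Ico a (a + K) | P n} ≤ #{n ∈ Ico a (a + L) | P n} :=
    card_le_card (filter_subset_filter _ (Ico_subset_Ico_right (by lia)))
  have hfloor : N / M * M ≤ N := Nat.div_mul_le_self N M
  have hceil : N ≤ (N / M + 1) * M := (Nat.lt_mul_of_div_lt (Nat.lt_succ_self _) hM).le
  have hlower : (N / M : ℕ) * (M.count P : ℝ) ≤ #{n ∈ Ico a (a + N) | P n} := by
    have := hmono hfloor
    rw [card_filter_Ico_mul_of_periodic P hP] at this
    exact_mod_cast this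
  have hupper : (#{n ∈ Ico a (a + N) | P n} : ℝ) ≤ ((N / M : ℕ) + 1) * M.count P := by
    have := hmono hceil
    rw [card_filter_Ico_mul_of_periodic P hP] at this
    exact_mod_cast this
  have hM' : (0 : ℝ) < M := mod_cast hM
  have hcount : (M.count P : ℝ) ≤ M := mod_cast Nat.count_le _
  have hdiv : ((N / M : ℕ) : ℝ) ≤ N / M := (le_div_iff₀ hM').2 (mod_cast hfloor)
  have hdiv' : (N : ℝ) / M ≤ (N / M : ℕ) + 1 := (div_le_iff₀ hM').2 (mod_cast hceil)
  have hcount0 : (0 : ℝ) ≤ M.count P := Nat.cast_nonneg _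
  rw [mul_div_left_comm, abs_le]
  constructor <;>
    linarith [mul_le_mul_of_nonneg_right hdiv hcount0, mul_le_mul_of_nonneg_right hdiv' hcount0]

variable {ι : Type*} [Fintype ι] {q : ι → ℕ}

theorem count_forall_natCast_mem (hq0 : ∀ i, q i ≠ 0)
    (hq : Pairwise (Function.onFun Nat.Coprime q)) (B : ∀ i, Finset (ZMod (q i))) :
    (∏ i, q i).count (fun n => ∀ i, (n : ZMod (q i)) ∈ B i) = ∏ i, #(B i) := by
  classical
  have : NeZero (∏ i, q i) := ⟨prod_ne_zero_iff.2 fun i _ => hq0 i⟩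
  rw [Nat.count_eq_card_filter_range, ← Fintype.card_piFinset]
  refine card_bij (fun n _ i => (n : ZMod (q i))) (fun n hn => ?_) (fun n hn n' hn' h => ?_)
    fun f hf => ?_
  · exact Fintype.mem_piFinset.2 (mem_filter.1 hn).2
  · have hcast : (n : ZMod (∏ i, q i)) = n' := by
      apply (ZMod.prodEquivPi q hq).injective
      simpa only [map_natCast, Pi.natCast_def] using h
    rwa [ZMod.natCast_eq_natCast_iff', Nat.mod_eq_of_lt (mem_range.1 (mem_filter.1 hn).1),
      Nat.mod_eq_of_lt (mem_range.1 (mem_filter.1 hn').1)] at hcast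
  · set b := (ZMod.prodEquivPi q hq).symm f with hb
    have hbf : (fun i => ((b.val : ℕ) : ZMod (q i))) = f := by
      have := map_natCast (ZMod.prodEquivPi q hq) b.val
      rw [ZMod.natCast_zmod_val, hb, RingEquiv.apply_symm_apply] at this
      exact this.symm
    refine ⟨b.val, mem_filter.2 ⟨mem_range.2 (ZMod.val_lt b), fun i => ?_⟩, hbf⟩
    exact congrFun hbf i ▸ Fintype.mem_piFinset.1 hf i

theorem abs_card_forall_natCast_mem_sub_le (hq0 : ∀ i, q i ≠ 0)
    (hq : Pairwise (Function.onFun Nat.Coprime q)) (B : ∀ i, Finset (ZMod (q i))) (a N : ℕ) :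
    |(#{n ∈ Ico a (a + N) | ∀ i, ((n : ℕ) : ZMod (q i)) ∈ B i} : ℝ) -
      N * ∏ i, (#(B i) / q i : ℝ)| ≤ ∏ i, (q i : ℝ) := by
  have hper : Function.Periodic (fun n : ℕ => ∀ i, (n : ZMod (q i)) ∈ B i) (∏ i, q i) := by
    intro n
    refine propext (forall_congr' fun i => ?_)
    rw [Nat.cast_add, (ZMod.natCast_eq_zero_iff _ _).2 (dvd_prod_of_mem q (mem_univ i)), add_zero]
  have := abs_card_filter_Ico_sub_le _ (Nat.pos_of_ne_zero (prod_ne_zero_iff.2 fun i _ => hq0 i))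
    hper a N
  rwa [count_forall_natCast_mem hq0 hq B, Nat.cast_prod, Nat.cast_prod, ← prod_div_distrib] at this

end CongruenceConditions

/-- Admissible tuples: those that leave out some residue class modulo every prime. The others
contain a multiple of a fixed prime at every translate. -/
def IsAdmissible {m : ℕ} (h : Fin (m + 1) → ℕ) : Prop :=
  ∀ p : ℕ, p.Prime → residueCount h p < p

section ResidueCount

variable {m : ℕ} (h : Fin (m + 1) → ℕ)

theorem one_le_residueCount (p : ℕ) : 1 ≤ residueCount h p :=
  Finset.card_pos.2 (Finset.univ_nonempty.image _)

theorem residueCount_le (p : ℕ) : residueCount h p ≤ m + 1 :=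
  Finset.card_image_le.trans (by simp)

theorem residueCount_le_self {p : ℕ} (hp : p.Prime) : residueCount h p ≤ p := by
  have : NeZero p := ⟨hp.ne_zero⟩
  exact (Finset.card_le_univ _).trans (by simp)

end ResidueCount

section ConstellationSieve

open Finset BoundingSieve

variable {m : ℕ} {h : Fin (m + 1) → ℕ}

theorem sum_image_ite_card_fiber {α β : Type*} [DecidableEq β] (s : Finset α) (f : α → β)
    (P : β → Prop) [DecidablePred P] :
    (∑ b ∈ s.image f, if P b then (#{a ∈ s | f a = b} : ℝ) else 0) = #{a ∈ s | P (f a)} := by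
  rw [card_eq_sum_card_fiberwise (t := s.image f)
    fun a ha => mem_image_of_mem f (mem_filter.1 ha).1, Nat.cast_sum]
  refine sum_congr rfl fun b _ => ?_
  rw [filter_filter]
  split_ifs with hb
  · congr 2
    exact filter_congr fun a _ => ⟨fun hab => ⟨hab.symm ▸ hb, hab⟩, And.right⟩
  · rw [filter_false_of_mem fun a _ (hab : P (f a) ∧ f a = b) => hb (hab.2 ▸ hab.1), card_empty,
      Nat.cast_zero]

/-- The sieve problem of removing from the interval `[a, a + N)` those `n` for which some `n + h j`
has a prime factor up to `z`. The integers being sifted are the products `∏ j, (n + h j)`, weighted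
by the number of `n` at which they are attained. -/
noncomputable def constellationSieve (hadm : IsAdmissible h) (z a N : ℕ) : BoundingSieve where
  support := (Ico a (a + N)).image fun n => ∏ j, (n + h j)
  prodPrimes := primorial z
  prodPrimes_squarefree := squarefree_primorial z
  weights x := #{n ∈ Ico a (a + N) | ∏ j, (n + h j) = x}
  weights_nonneg _ := Nat.cast_nonneg _
  totalMass := N
  nu := ArithmeticFunction.prodPrimeFactors fun p => (residueCount h p / p : ℝ)
  nu_mult := ArithmeticFunction.IsMultiplicative.prodPrimeFactors _
  nu_pos_of_prime p hp _ := by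
    have := one_le_residueCount h p
    rw [ArithmeticFunction.prodPrimeFactors_apply hp.ne_zero, hp.primeFactors, prod_singleton]
    exact div_pos (mod_cast this) (mod_cast hp.pos)
  nu_lt_one_of_prime p hp _ := by
    rw [ArithmeticFunction.prodPrimeFactors_apply hp.ne_zero, hp.primeFactors, prod_singleton,
      div_lt_one (mod_cast hp.pos)]
    exact mod_cast hadm p hp

theorem dvd_prod_add_iff {d : ℕ} (hd : Squarefree d) (n : ℕ) :
    d ∣ ∏ j, (n + h j) ↔
      ∀ p : d.primeFactors, (n : ZMod p) ∈ univ.image fun j => -(h j : ZMod p) := by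
  have hprime (p : d.primeFactors) : (n : ZMod p) ∈ univ.image (fun j => -(h j : ZMod p)) ↔
      (p : ℕ) ∣ ∏ j, (n + h j) := by
    simp [(Nat.prime_of_mem_primeFactors p.2).prime.dvd_finsetProd_iff,
      ← ZMod.natCast_eq_zero_iff, ← eq_neg_iff_add_eq_zero, eq_comm]
  simp only [hprime, Subtype.forall]
  refine ⟨fun hdvd p hp => (Nat.dvd_of_mem_primeFactors hp).trans hdvd, fun hdvd => ?_⟩
  rw [← Nat.prod_primeFactors_of_squarefree hd]
  exact prod_primes_dvd _ (fun p hp => (Nat.prime_of_mem_primeFactors hp).prime) hdvd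

theorem card_image_neg_natCast (p : ℕ) :
    #(univ.image fun j => -(h j : ZMod p)) = residueCount h p := by
  rw [residueCount, ← card_image_of_injective (univ.image fun j => (h j : ZMod p)) neg_injective,
    image_image]
  rfl

theorem abs_rem_constellationSieve_le (hadm : IsAdmissible h) (z a N : ℕ) {d : ℕ}
    (hd : d ∣ primorial z) : |(constellationSieve hadm z a N).rem d| ≤ d := by
  have hsq : Squarefree d := (squarefree_primorial z).squarefree_of_dvd hd
  have hcoprime : Pairwise (Function.onFun Nat.Coprime fun p : d.primeFactors => (p : ℕ)) :=
    fun p q hpq => (Nat.coprime_primes (Nat.prime_of_mem_primeFactors p.2)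
      (Nat.prime_of_mem_primeFactors q.2)).2 (Subtype.coe_ne_coe.2 hpq)
  have hcount := abs_card_forall_natCast_mem_sub_le
    (fun p : d.primeFactors => (Nat.prime_of_mem_primeFactors p.2).ne_zero) hcoprime
    (fun p => univ.image fun j => -(h j : ZMod p)) a N
  simp only [← dvd_prod_add_iff hsq, card_image_neg_natCast] at hcount
  rw [prod_coe_sort d.primeFactors fun p => (residueCount h p / p : ℝ),
    prod_coe_sort d.primeFactors fun p => (p : ℝ), ← Nat.cast_prod,
    Nat.prod_primeFactors_of_squarefree hsq] at hcount
  rwa [rem, multSum, constellationSieve, sum_image_ite_card_fiber,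
    ArithmeticFunction.prodPrimeFactors_apply hsq.ne_zero, mul_comm]

theorem siftedSum_constellationSieve (hadm : IsAdmissible h) (z a N : ℕ) :
    (constellationSieve hadm z a N).siftedSum =
      #{n ∈ Ico a (a + N) | (primorial z).Coprime (∏ j, (n + h j))} := by
  rw [siftedSum, constellationSieve, sum_image_ite_card_fiber]

theorem nu_constellationSieve (hadm : IsAdmissible h) (z a N : ℕ) {d : ℕ} (hd : d ≠ 0) :
    (constellationSieve hadm z a N).nu d = ∏ p ∈ d.primeFactors, (residueCount h p / p : ℝ) :=
  ArithmeticFunction.prodPrimeFactors_apply hd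

theorem inv_le_nu_constellationSieve (hadm : IsAdmissible h) (z a N : ℕ) {d : ℕ}
    (hd : d ∣ primorial z) : (d : ℝ)⁻¹ ≤ (constellationSieve hadm z a N).nu d := by
  have hsq : Squarefree d := (squarefree_primorial z).squarefree_of_dvd hd
  rw [nu_constellationSieve hadm z a N hsq.ne_zero]
  nth_rw 1 [← Nat.prod_primeFactors_of_squarefree hsq]
  rw [Nat.cast_prod, ← prod_inv_distrib]
  refine prod_le_prod (fun p _ => by positivity) fun p _ => ?_
  rw [inv_eq_one_div]
  gcongr
  exact mod_cast one_le_residueCount h p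

theorem card_coprime_prod_add_le (hadm : IsAdmissible h) {z : ℕ} (hz : 2 ≤ z) (a N : ℕ) :
    (#{n ∈ Ico a (a + N) | (primorial z).Coprime (∏ j, (n + h j))} : ℝ) ≤
      2 * N * ∏ p ∈ Nat.primesLE z, (1 - (residueCount h p : ℝ) / p) +
        (z : ℝ) ^ (6 * (6 * (m + 1) + 1)) := by
  set s := constellationSieve hadm z a N with hs
  have hnu {p : ℕ} (hp : p ∈ Nat.primesLE z) : s.nu p = residueCount h p / p := by
    have hp := Nat.prime_of_mem_primesLE hp
    rw [nu_constellationSieve hadm z a N hp.ne_zero, hp.primeFactors, prod_singleton]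
  have hfactors : s.prodPrimes.primeFactors = Nat.primesLE z := primeFactors_primorial z
  have hselberg := half_prod_le_selbergSum (s := s) (k := m + 1) hz
    (fun p hp => (Nat.mem_primesLE.1 (hfactors ▸ hp)).1) fun p hp => by
      rw [hnu (hfactors ▸ hp)]
      gcongr
      exact residueCount_le h p
  have hV : 0 < ∏ p ∈ Nat.primesLE z, (1 - (residueCount h p : ℝ) / p) :=
    prod_pos fun p hp => sub_pos.2 <| by
      have hp := Nat.prime_of_mem_primesLE hp
      exact (div_lt_one (mod_cast hp.pos)).2 (mod_cast hadm p hp)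
  rw [hfactors, prod_congr rfl fun p hp => congrArg (fun x => (1 - x)⁻¹) (hnu hp),
    prod_inv_distrib] at hselberg
  have hsieve := siftedSum_le_totalMass_div_selbergSum_add (s := s)
    (y := z ^ (6 * (m + 1) + 1)) (Nat.one_le_pow _ _ (by lia))
    (fun d hd => inv_le_nu_constellationSieve hadm z a N hd)
    fun d hd => abs_rem_constellationSieve_le hadm z a N hd
  rw [hs, siftedSum_constellationSieve, ← hs, Nat.cast_pow, ← pow_mul, mul_comm _ 6] at hsieve
  refine hsieve.trans (add_le_add_left ?_ _)
  calc (N : ℝ) / selbergSum s (z ^ (6 * (m + 1) + 1))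
      ≤ N / (1 / 2 * (∏ p ∈ Nat.primesLE z, (1 - (residueCount h p : ℝ) / p))⁻¹) := by gcongr
    _ = 2 * N * ∏ p ∈ Nat.primesLE z, (1 - (residueCount h p : ℝ) / p) := by field_simp

end ConstellationSieve

/-- The Euler factor of the singular series at an arbitrary natural number, so that it can be
multiplied over sets of natural numbers; at primes it is `singularFactor`. -/
noncomputable def eulerFactor {m : ℕ} (h : Fin (m + 1) → ℕ) (p : ℕ) : ℝ :=
  (1 - (residueCount h p : ℝ) / p) / (1 - 1 / (p : ℝ)) ^ (m + 1)

/-- The product of the differences of the entries of a tuple. For an increasing tuple, a prime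
divides it exactly when two entries agree modulo that prime. -/
def differenceProduct {m : ℕ} (h : Fin (m + 1) → ℕ) : ℕ :=
  ∏ i, ∏ j ∈ Finset.Ioi i, (h j - h i)

section SingularSeries

open Finset Filter Topology

theorem one_le_inv_one_sub_inv {p : ℕ} (hp : 2 ≤ p) : 1 ≤ (1 - 1 / (p : ℝ))⁻¹ :=
  (one_le_inv₀ (one_sub_inv_pos hp)).2 (sub_le_self _ (by positivity))

theorem inv_one_sub_inv_le_exp {p : ℕ} (hp : 2 ≤ p) :
    (1 - 1 / (p : ℝ))⁻¹ ≤ Real.exp (2 / p) := by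
  have hhalf : 1 / (p : ℝ) ≤ 1 / 2 := one_div_le_one_div_of_le two_pos (mod_cast hp)
  calc (1 - 1 / (p : ℝ))⁻¹ ≤ 2 * (1 / p) + 1 := by
        rw [inv_le_iff_one_le_mul₀ (one_sub_inv_pos hp)]
        nlinarith [show 0 ≤ 1 / (p : ℝ) by positivity]
    _ ≤ Real.exp (2 / p) := by
        rw [mul_one_div]
        exact Real.add_one_le_exp _

theorem one_sub_sum_le_prod_one_sub {ι : Type*} (s : Finset ι) {a : ι → ℝ}
    (h0 : ∀ i ∈ s, 0 ≤ a i) (h1 : ∀ i ∈ s, a i ≤ 1) :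
    1 - ∑ i ∈ s, a i ≤ ∏ i ∈ s, (1 - a i) := by
  induction s using Finset.cons_induction with
  | empty => simp
  | cons i s hi ih =>
    obtain ⟨hi0, h0⟩ := forall_mem_cons _ _ |>.1 h0
    obtain ⟨hi1, h1⟩ := forall_mem_cons _ _ |>.1 h1
    rw [sum_cons, prod_cons]
    nlinarith [mul_le_mul_of_nonneg_left (ih h0 h1) (sub_nonneg.2 hi1),
      mul_nonneg hi0 (sum_nonneg h0)]

theorem sum_inv_sq_le_inv {k : ℕ} (hk : k ≠ 0) {s : Finset ℕ} (hs : ∀ n ∈ s, k < n) :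
    ∑ n ∈ s, ((n : ℝ) ^ 2)⁻¹ ≤ (k : ℝ)⁻¹ := by
  have hsub : s ⊆ Ioc k (max k (s.sup id)) := fun n hn =>
    mem_Ioc.2 ⟨hs n hn, le_max_of_le_right (le_sup (f := id) hn)⟩
  calc ∑ n ∈ s, ((n : ℝ) ^ 2)⁻¹ ≤ ∑ n ∈ Ioc k (max k (s.sup id)), ((n : ℝ) ^ 2)⁻¹ :=
        sum_le_sum_of_subset_of_nonneg hsub fun n _ _ => by positivity
    _ ≤ (k : ℝ)⁻¹ - ((max k (s.sup id) : ℕ) : ℝ)⁻¹ :=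
        sum_Ioc_inv_sq_le_sub hk (le_max_left _ _)
    _ ≤ (k : ℝ)⁻¹ := sub_le_self _ (by positivity)

theorem card_primeFactors_mul_log_two_le {n : ℕ} (hn : n ≠ 0) :
    #n.primeFactors * Real.log 2 ≤ Real.log n := by
  have hpow : 2 ^ #n.primeFactors ≤ n :=
    (pow_card_le_prod _ _ _ fun _ hp => (Nat.prime_of_mem_primeFactors hp).two_le).trans
      (Nat.le_of_dvd (Nat.pos_of_ne_zero hn) (Nat.prod_primeFactors_dvd n))
  rw [← Real.log_pow]
  exact Real.log_le_log (by positivity) (mod_cast hpow)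

theorem prod_primeFactors_inv_one_sub_inv_le {n w : ℕ} (hn : n ≠ 0) (hw : 2 ≤ w) :
    ∏ p ∈ n.primeFactors, (1 - 1 / (p : ℝ))⁻¹ ≤
      Real.exp 6 * (1 + Real.log w) * Real.exp (4 * Real.log n / w) := by
  have hone {p : ℕ} (hp : p.Prime) : 1 ≤ (1 - 1 / (p : ℝ))⁻¹ := one_le_inv_one_sub_inv hp.two_le
  have hsmall : ∏ p ∈ n.primeFactors with p ≤ w, (1 - 1 / (p : ℝ))⁻¹ ≤
      Real.exp 6 * (1 + Real.log w) := by
    refine le_trans ?_ (prod_primesLE_inv_one_sub_inv_le hw)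
    have hsub : {p ∈ n.primeFactors | p ≤ w} ⊆ Nat.primesLE w := fun p hp =>
      Nat.mem_primesLE.2 ⟨(mem_filter.1 hp).2, Nat.prime_of_mem_primeFactors (mem_filter.1 hp).1⟩
    exact prod_le_prod_of_subset_of_one_le hsub
      (fun p hp => zero_le_one.trans (hone (Nat.prime_of_mem_primesLE (hsub hp))))
      fun p hp _ => hone (Nat.prime_of_mem_primesLE hp)
  have hlarge : ∏ p ∈ n.primeFactors with ¬ p ≤ w, (1 - 1 / (p : ℝ))⁻¹ ≤
      Real.exp (4 * Real.log n / w) := by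
    have hfactor (p : ℕ) (hp : p ∈ n.primeFactors.filter fun p => ¬ p ≤ w) :
        0 ≤ (1 - 1 / (p : ℝ))⁻¹ ∧ (1 - 1 / (p : ℝ))⁻¹ ≤ Real.exp (2 / w) := by
      obtain ⟨hp, hwp⟩ := mem_filter.1 hp
      have hp := Nat.prime_of_mem_primeFactors hp
      refine ⟨zero_le_one.trans (hone hp), (inv_one_sub_inv_le_exp hp.two_le).trans ?_⟩
      gcongr
      exact (not_le.1 hwp).le
    calc ∏ p ∈ n.primeFactors with ¬ p ≤ w, (1 - 1 / (p : ℝ))⁻¹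
        ≤ Real.exp (2 / w) ^ #{p ∈ n.primeFactors | ¬ p ≤ w} :=
          (prod_le_prod (fun p hp => (hfactor p hp).1) fun p hp => (hfactor p hp).2).trans_eq
            (prod_const _)
      _ = Real.exp (2 * #{p ∈ n.primeFactors | ¬ p ≤ w} / w) := by
          rw [← Real.exp_nat_mul]
          ring_nf
      _ ≤ Real.exp (4 * Real.log n / w) := by
          have hcard : (#{p ∈ n.primeFactors | ¬ p ≤ w} : ℝ) ≤ #n.primeFactors :=
            mod_cast card_filter_le _ _
          refine Real.exp_le_exp.2 (div_le_div_of_nonneg_right ?_ (Nat.cast_nonneg w))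
          nlinarith [card_primeFactors_mul_log_two_le hn, Real.log_two_gt_d9]
  rw [← prod_filter_mul_prod_filter_not n.primeFactors (· ≤ w)]
  exact mul_le_mul hsmall hlarge (prod_nonneg fun p hp => zero_le_one.trans
    (hone (Nat.prime_of_mem_primeFactors (mem_filter.1 hp).1))) (by positivity)

variable {m : ℕ} (h : Fin (m + 1) → ℕ)

theorem eulerFactor_nonneg {p : ℕ} (hp : p.Prime) : 0 ≤ eulerFactor h p := by
  refine div_nonneg (sub_nonneg.2 ?_) (pow_nonneg (one_sub_inv_pos hp.two_le).le _)
  rw [div_le_one (mod_cast hp.pos)]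
  exact mod_cast residueCount_le_self h hp

theorem eulerFactor_le_inv_pow {p : ℕ} (hp : p.Prime) :
    eulerFactor h p ≤ (1 - 1 / (p : ℝ))⁻¹ ^ m := by
  have hpos := one_sub_inv_pos hp.two_le
  calc eulerFactor h p ≤ (1 - 1 / (p : ℝ)) / (1 - 1 / (p : ℝ)) ^ (m + 1) := by
        unfold eulerFactor
        gcongr
        exact mod_cast one_le_residueCount h p
    _ = (1 - 1 / (p : ℝ))⁻¹ ^ m := by
        rw [pow_succ, inv_pow]
        field_simp

variable {h} in
theorem eulerFactor_le_one {p : ℕ} (hp : p.Prime) (hr : residueCount h p = m + 1) :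
    eulerFactor h p ≤ 1 := by
  have hpos := one_sub_inv_pos hp.two_le
  have hbernoulli := one_add_mul_le_pow (a := -(1 / (p : ℝ))) (by linarith) (m + 1)
  rw [eulerFactor, div_le_one (pow_pos hpos _), hr]
  rw [← sub_eq_add_neg] at hbernoulli
  exact le_trans (le_of_eq (by ring)) hbernoulli

theorem one_sub_le_eulerFactor {p : ℕ} (hp : p.Prime) (hmp : m + 1 ≤ p) :
    1 - ((m : ℝ) + 1) ^ 2 * ((p : ℝ) ^ 2)⁻¹ ≤ eulerFactor h p := by
  set x : ℝ := 1 / p with hx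
  have hx0 : 0 ≤ x := by positivity
  have hx1 : 0 < 1 - x := one_sub_inv_pos hp.two_le
  have hkx : ((m : ℝ) + 1) * x ≤ 1 := by
    rw [hx, mul_one_div, div_le_one (mod_cast hp.pos)]
    exact mod_cast hmp
  have hresidue : (residueCount h p : ℝ) / p ≤ (m + 1) * x := by
    rw [hx, mul_one_div]
    gcongr
    exact mod_cast residueCount_le h p
  have hbernoulli : (1 - x) ^ (m + 1) * (1 + (m + 1) * x) ≤ 1 :=
    calc (1 - x) ^ (m + 1) * (1 + (m + 1) * x) ≤ (1 - x) ^ (m + 1) * (1 + x) ^ (m + 1) := by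
          gcongr
          exact mod_cast one_add_mul_le_pow (a := x) (by linarith) (m + 1)
      _ = (1 - x ^ 2) ^ (m + 1) := by rw [← mul_pow]; ring
      _ ≤ 1 := pow_le_one₀ (by nlinarith) (by nlinarith)
  rw [eulerFactor, ← hx, le_div_iff₀ (pow_pos hx1 _)]
  calc (1 - ((m : ℝ) + 1) ^ 2 * ((p : ℝ) ^ 2)⁻¹) * (1 - x) ^ (m + 1)
      = (1 - x) ^ (m + 1) * (1 + (m + 1) * x) * (1 - (m + 1) * x) := by
        rw [hx]
        ring
    _ ≤ 1 - (m + 1) * x := mul_le_of_le_one_left (by linarith) hbernoulli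
    _ ≤ 1 - residueCount h p / p := by linarith

theorem half_le_prod_eulerFactor {G : Finset ℕ} (hG : ∀ p ∈ G, p.Prime)
    (hlarge : ∀ p ∈ G, 2 * (m + 1) ^ 2 < p) : 1 / 2 ≤ ∏ p ∈ G, eulerFactor h p := by
  have hmp (p : ℕ) (hp : p ∈ G) : m + 1 ≤ p := by nlinarith [hlarge p hp]
  have hle_one (p : ℕ) (hp : p ∈ G) : ((m : ℝ) + 1) ^ 2 * ((p : ℝ) ^ 2)⁻¹ ≤ 1 := by
    have hp0 : (0 : ℝ) < p := mod_cast (hG p hp).pos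
    rw [← div_eq_mul_inv, div_le_one (by positivity)]
    gcongr
    exact mod_cast hmp p hp
  have hsum : ∑ p ∈ G, ((m : ℝ) + 1) ^ 2 * ((p : ℝ) ^ 2)⁻¹ ≤ 1 / 2 :=
    calc ∑ p ∈ G, ((m : ℝ) + 1) ^ 2 * ((p : ℝ) ^ 2)⁻¹
        ≤ ((m : ℝ) + 1) ^ 2 * ((2 * (m + 1) ^ 2 : ℕ) : ℝ)⁻¹ := by
          rw [← mul_sum]
          gcongr
          exact sum_inv_sq_le_inv (by positivity) hlarge
      _ = 1 / 2 := by
          push_cast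
          field_simp
  calc (1 : ℝ) / 2 ≤ 1 - ∑ p ∈ G, ((m : ℝ) + 1) ^ 2 * ((p : ℝ) ^ 2)⁻¹ := by linarith
    _ ≤ ∏ p ∈ G, (1 - ((m : ℝ) + 1) ^ 2 * ((p : ℝ) ^ 2)⁻¹) :=
        one_sub_sum_le_prod_one_sub G (fun p _ => by positivity) hle_one
    _ ≤ ∏ p ∈ G, eulerFactor h p :=
        prod_le_prod (fun p hp => sub_nonneg.2 (hle_one p hp))
          fun p hp => one_sub_le_eulerFactor h (hG p hp) (hmp p hp)

variable {h}

theorem differenceProduct_ne_zero (hh : StrictMono h) : differenceProduct h ≠ 0 :=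
  prod_ne_zero_iff.2 fun _ _ => prod_ne_zero_iff.2 fun _ hj =>
    (Nat.sub_pos_of_lt (hh (mem_Ioi.1 hj))).ne'

theorem differenceProduct_le_pow {B : ℕ} (hB0 : 1 ≤ B) (hB : ∀ j, h j ≤ B) :
    differenceProduct h ≤ B ^ (m + 1) ^ 2 := by
  have hinner (i : Fin (m + 1)) : ∏ j ∈ Ioi i, (h j - h i) ≤ B ^ (m + 1) :=
    (prod_le_pow_card _ _ B fun j _ => (Nat.sub_le _ _).trans (hB j)).trans
      (Nat.pow_le_pow_right hB0 (by simpa using card_le_univ (Ioi i)))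
  calc differenceProduct h ≤ (B ^ (m + 1)) ^ #(univ : Finset (Fin (m + 1))) :=
        prod_le_pow_card _ _ _ fun i _ => hinner i
    _ = B ^ (m + 1) ^ 2 := by rw [card_univ, Fintype.card_fin, ← pow_mul, sq]

theorem residueCount_eq_of_not_dvd_differenceProduct (hh : StrictMono h) {p : ℕ}
    (hp : ¬ p ∣ differenceProduct h) : residueCount h p = m + 1 := by
  have hne {i j : Fin (m + 1)} (hij : i < j) : (h i : ZMod p) ≠ h j := by
    intro heq
    have hdvd : p ∣ h j - h i := by
      rw [← ZMod.natCast_eq_zero_iff, Nat.cast_sub (hh hij).le, heq, sub_self]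
    exact hp (hdvd.trans ((dvd_prod_of_mem _ (mem_Ioi.2 hij)).trans
      (dvd_prod_of_mem (fun i => ∏ j ∈ Ioi i, (h j - h i)) (mem_univ i))))
  have hinj : Function.Injective fun j => (h j : ZMod p) := fun i j hij => by
    rcases lt_trichotomy i j with hlt | heq | hlt
    exacts [absurd hij (hne hlt), heq, absurd hij.symm (hne hlt)]
  rw [residueCount, card_image_of_injective _ hinj, card_univ, Fintype.card_fin]

theorem multipliable_singularFactor (hh : StrictMono h) : Multipliable (singularFactor h) := by
  have hlarge : ∀ᶠ p : Nat.Primes in cofinite,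
      max (m + 1) (differenceProduct h + 1) ≤ (p : ℕ) := by
    rw [eventually_cofinite]
    exact ((Set.finite_lt_nat (max (m + 1) (differenceProduct h + 1))).preimage
      Subtype.val_injective.injOn).subset fun p hp => not_le.1 hp
  have hsum : Summable fun p : Nat.Primes => ((m : ℝ) + 1) ^ 2 * (((p : ℕ) : ℝ) ^ 2)⁻¹ :=
    ((Real.summable_nat_pow_inv.2 one_lt_two).comp_injective Subtype.val_injective).mul_left _
  have hsub : Summable fun p : Nat.Primes => singularFactor h p - 1 := by
    refine hsum.of_norm_bounded_eventually ?_
    filter_upwards [hlarge] with p hp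
    have hlower := one_sub_le_eulerFactor h p.2 ((le_max_left _ _).trans hp)
    have hupper : eulerFactor h p ≤ 1 :=
      eulerFactor_le_one p.2 <| residueCount_eq_of_not_dvd_differenceProduct hh fun hdvd =>
        (Nat.le_of_dvd (Nat.pos_of_ne_zero (differenceProduct_ne_zero hh)) hdvd).not_gt
          ((le_max_right _ _).trans hp)
    change |eulerFactor h p - 1| ≤ _
    rw [abs_of_nonpos (sub_nonpos.2 hupper)]
    linarith
  simpa only [add_sub_cancel] using Real.multipliable_one_add_of_summable hsub

theorem tendsto_prod_primesLE_eulerFactor (hh : StrictMono h) :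
    Tendsto (fun n => ∏ p ∈ Nat.primesLE n, eulerFactor h p) atTop (𝓝 (singularSeries h)) := by
  have hexhaust : Tendsto (fun n => (Nat.primesLE n).subtype Nat.Prime) atTop atTop := by
    refine tendsto_atTop_finset_of_monotone (fun a b hab p hp => ?_)
      fun p => ⟨p, mem_subtype.2 (Nat.mem_primesLE.2 ⟨le_rfl, p.2⟩)⟩
    rw [mem_subtype, Nat.mem_primesLE] at hp ⊢
    exact ⟨hp.1.trans hab, hp.2⟩
  refine (Tendsto.comp (multipliable_singularFactor hh).hasProd hexhaust).congr fun n => ?_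
  exact prod_subtype_of_mem (eulerFactor h) fun p hp => Nat.prime_of_mem_primesLE hp

theorem half_prod_le_singularSeries (hh : StrictMono h) {z : ℕ} (hz : 2 * (m + 1) ^ 2 ≤ z) :
    1 / 2 * ∏ p ∈ Nat.primesLE z, eulerFactor h p ≤ singularSeries h := by
  refine ge_of_tendsto (tendsto_prod_primesLE_eulerFactor hh) ?_
  filter_upwards [eventually_ge_atTop z] with n hn
  have hsub : Nat.primesLE z ⊆ Nat.primesLE n := fun p hp => by
    rw [Nat.mem_primesLE] at hp ⊢
    exact ⟨hp.1.trans hn, hp.2⟩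
  rw [← prod_sdiff hsub]
  refine mul_le_mul_of_nonneg_right (half_le_prod_eulerFactor h
    (fun p hp => Nat.prime_of_mem_primesLE (mem_sdiff.1 hp).1) fun p hp => ?_)
    (prod_nonneg fun p hp => eulerFactor_nonneg h (Nat.prime_of_mem_primesLE hp))
  obtain ⟨hpn, hpz⟩ := mem_sdiff.1 hp
  exact hz.trans_lt (not_le.1 fun hle =>
    hpz (Nat.mem_primesLE.2 ⟨hle, Nat.prime_of_mem_primesLE hpn⟩))

theorem singularSeries_nonneg (hh : StrictMono h) : 0 ≤ singularSeries h :=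
  ge_of_tendsto (tendsto_prod_primesLE_eulerFactor hh) (.of_forall fun _ =>
    prod_nonneg fun _ hp => eulerFactor_nonneg h (Nat.prime_of_mem_primesLE hp))

theorem singularSeries_le_prod_primeFactors_pow (hh : StrictMono h) :
    singularSeries h ≤
      (∏ p ∈ (differenceProduct h).primeFactors, (1 - 1 / (p : ℝ))⁻¹) ^ m := by
  set D := (differenceProduct h).primeFactors
  have hone (p : ℕ) (hp : p ∈ D) : 1 ≤ (1 - 1 / (p : ℝ))⁻¹ ^ m :=
    one_le_pow₀ (one_le_inv_one_sub_inv (Nat.prime_of_mem_primeFactors hp).two_le)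
  refine le_of_tendsto (tendsto_prod_primesLE_eulerFactor hh) (.of_forall fun n => ?_)
  have hfactor (p : ℕ) (hp : p ∈ Nat.primesLE n) :
      eulerFactor h p ≤ if p ∈ D then (1 - 1 / (p : ℝ))⁻¹ ^ m else 1 := by
    have hp := Nat.prime_of_mem_primesLE hp
    split_ifs with hpD
    · exact eulerFactor_le_inv_pow h hp
    · refine eulerFactor_le_one hp (residueCount_eq_of_not_dvd_differenceProduct hh fun hdvd => ?_)
      exact hpD (Nat.mem_primeFactors.2 ⟨hp, hdvd, differenceProduct_ne_zero hh⟩)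
  calc ∏ p ∈ Nat.primesLE n, eulerFactor h p
      ≤ ∏ p ∈ Nat.primesLE n, if p ∈ D then (1 - 1 / (p : ℝ))⁻¹ ^ m else 1 :=
        prod_le_prod (fun p hp => eulerFactor_nonneg h (Nat.prime_of_mem_primesLE hp)) hfactor
    _ = ∏ p ∈ Nat.primesLE n ∩ D, (1 - 1 / (p : ℝ))⁻¹ ^ m := prod_ite_mem _ _ _
    _ ≤ ∏ p ∈ D, (1 - 1 / (p : ℝ))⁻¹ ^ m :=
        prod_le_prod_of_subset_of_one_le inter_subset_right
          (fun p hp => zero_le_one.trans (hone p (mem_inter.1 hp).2)) fun p hp _ => hone p hp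
    _ = (∏ p ∈ D, (1 - 1 / (p : ℝ))⁻¹) ^ m := prod_pow _ _ _

theorem log_differenceProduct_le (hh : StrictMono h) {X : ℝ} (hX : 2 ≤ X)
    (hhX : (h (Fin.last m) : ℝ) ≤ 2 * X) :
    Real.log (differenceProduct h) ≤ 2 * (m + 1) ^ 2 * Real.log X := by
  have hfloor : 1 ≤ ⌊2 * X⌋₊ := Nat.le_floor (by rw [Nat.cast_one]; linarith)
  have hB (j : Fin (m + 1)) : h j ≤ ⌊2 * X⌋₊ :=
    (hh.monotone (Fin.le_last j)).trans (Nat.le_floor hhX)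
  have hpow : (differenceProduct h : ℝ) ≤ X ^ (2 * (m + 1) ^ 2) :=
    calc (differenceProduct h : ℝ) ≤ (⌊2 * X⌋₊ : ℝ) ^ (m + 1) ^ 2 :=
          mod_cast differenceProduct_le_pow hfloor hB
      _ ≤ (X ^ 2) ^ (m + 1) ^ 2 := by
          gcongr
          exact (Nat.floor_le (by linarith)).trans (by nlinarith)
      _ = X ^ (2 * (m + 1) ^ 2) := (pow_mul _ _ _).symm
  calc Real.log (differenceProduct h) ≤ Real.log (X ^ (2 * (m + 1) ^ 2)) :=
        Real.log_le_log (mod_cast Nat.pos_of_ne_zero (differenceProduct_ne_zero hh)) hpow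
    _ = 2 * (m + 1) ^ 2 * Real.log X := by
        rw [Real.log_pow]
        push_cast
        rfl

theorem one_add_log_floor_log_le {X : ℝ} (hX : Real.exp 2 ≤ X) :
    1 + Real.log ↑(⌊Real.log X⌋₊ + 1) ≤ 4 * Real.log (Real.log (3 * X)) := by
  have hX0 : 0 < X := (Real.exp_pos 2).trans_le hX
  have hlog : 2 ≤ Real.log X := (Real.le_log_iff_exp_le hX0).2 hX
  have hle : ((⌊Real.log X⌋₊ + 1 : ℕ) : ℝ) ≤ Real.log X ^ 2 := by
    push_cast
    nlinarith [Nat.floor_le (zero_le_two.trans hlog)]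
  have hloglog : Real.log 2 ≤ Real.log (Real.log X) := Real.log_le_log two_pos hlog
  calc 1 + Real.log ↑(⌊Real.log X⌋₊ + 1) ≤ 1 + 2 * Real.log (Real.log X) := by
        grw [hle, Real.log_pow, Nat.cast_two]
    _ ≤ 4 * Real.log (Real.log X) := by linarith [Real.log_two_gt_d9]
    _ ≤ 4 * Real.log (Real.log (3 * X)) := by
        gcongr
        linarith

theorem singularSeries_le (hh : StrictMono h) {X : ℝ} (hX : Real.exp 2 ≤ X)
    (hhX : (h (Fin.last m) : ℝ) ≤ 2 * X) :
    singularSeries h ≤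
      (4 * Real.exp (6 + 8 * (m + 1) ^ 2)) ^ m * Real.log (Real.log (3 * X)) ^ m := by
  set w := ⌊Real.log X⌋₊ + 1 with hw
  have hlog : 2 ≤ Real.log X := (Real.le_log_iff_exp_le ((Real.exp_pos 2).trans_le hX)).2 hX
  have hw2 : 2 ≤ w := (Nat.le_floor (mod_cast hlog)).trans (Nat.le_succ _)
  have hlarge : 4 * Real.log (differenceProduct h) / w ≤ 8 * (m + 1) ^ 2 := by
    have hX2 : 2 ≤ X := by linarith [Real.add_one_le_exp (2 : ℝ)]
    have hwlog : Real.log X ≤ w := (Nat.lt_floor_add_one _).le.trans_eq (by rw [hw, Nat.cast_succ])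
    rw [div_le_iff₀ (by linarith)]
    calc 4 * Real.log (differenceProduct h) ≤ 4 * (2 * (m + 1) ^ 2 * Real.log X) := by
          gcongr
          exact log_differenceProduct_le hh hX2 hhX
      _ ≤ 4 * (2 * (m + 1) ^ 2 * w) := by gcongr
      _ = 8 * (m + 1) ^ 2 * w := by ring
  rw [← mul_pow]
  refine (singularSeries_le_prod_primeFactors_pow hh).trans (pow_le_pow_left₀
    (prod_nonneg fun p hp => zero_le_one.trans
      (one_le_inv_one_sub_inv (Nat.prime_of_mem_primeFactors hp).two_le)) ?_ m)
  calc _ ≤ Real.exp 6 * (1 + Real.log w) * Real.exp (4 * Real.log (differenceProduct h) / w) :=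
        prod_primeFactors_inv_one_sub_inv_le (differenceProduct_ne_zero hh) hw2
    _ ≤ Real.exp 6 * (4 * Real.log (Real.log (3 * X))) * Real.exp (8 * (m + 1) ^ 2) := by
        have hsmall : 1 + Real.log w ≤ 4 * Real.log (Real.log (3 * X)) :=
          one_add_log_floor_log_le hX
        have hnonneg : 0 ≤ 4 * Real.log (Real.log (3 * X)) := le_trans (by positivity) hsmall
        gcongr
    _ = 4 * Real.exp (6 + 8 * (m + 1) ^ 2) * Real.log (Real.log (3 * X)) := by
        rw [Real.exp_add]
        ring

theorem singularSeries_div_log_pow_le (hh : StrictMono h) {X : ℝ} (hX : Real.exp 2 ≤ X)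
    (hhX : (h (Fin.last m) : ℝ) ≤ 2 * X) :
    singularSeries h / Real.log X ^ m ≤ (4 * Real.exp (6 + 8 * (m + 1) ^ 2)) ^ m *
      (Real.log (Real.log (3 * X)) ^ m / Real.log X ^ m) := by
  have hlog : 0 < Real.log X :=
    Real.log_pos ((Real.one_lt_exp_iff.2 two_pos).trans_le hX)
  rw [← mul_div_assoc]
  gcongr
  exact singularSeries_le hh hX hhX

end SingularSeries

section Chebyshev

open Finset Filter

theorem log_centralBinom_le_psi_sub_theta_add (n : ℕ) :
    Real.log n.centralBinom ≤ (Chebyshev.psi ↑(2 * n) - Chebyshev.theta ↑(2 * n)) +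
      ∑ p ∈ n.centralBinom.primeFactors, Real.log p := by
  set s := n.centralBinom.primeFactors
  have hlog (p : ℕ) (hp : p ∈ Nat.primesLE (2 * n)) : 1 ≤ p.log (2 * n) := by
    rw [Nat.mem_primesLE] at hp
    exact Nat.log_pos hp.2.one_lt hp.1
  have hsub : s ⊆ Nat.primesLE (2 * n) := fun p hp => Nat.mem_primesLE.2
    ⟨Nat.le_two_mul_of_factorization_centralBinom_pos <|
      (Nat.prime_of_mem_primeFactors hp).factorization_pos_of_dvd n.centralBinom_ne_zero
        (Nat.dvd_of_mem_primeFactors hp), Nat.prime_of_mem_primeFactors hp⟩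
  have hexcess : ∑ p ∈ s, ((p.log (2 * n) : ℝ) - 1) * Real.log p ≤
      Chebyshev.psi ↑(2 * n) - Chebyshev.theta ↑(2 * n) := by
    rw [Chebyshev.psi_eq_sum_mul_log_prime, Chebyshev.theta_eq_sum_primesLE_log,
      ← sum_sub_distrib]
    simp only [← sub_one_mul]
    exact sum_le_sum_of_subset_of_nonneg hsub fun p hp _ =>
      mul_nonneg (sub_nonneg.2 (mod_cast hlog p hp)) (Real.log_natCast_nonneg p)
  calc Real.log n.centralBinom
      = ∑ p ∈ s, (n.centralBinom.factorization p : ℝ) * Real.log p :=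
        Real.log_nat_eq_sum_factorization _
    _ ≤ ∑ p ∈ s, (p.log (2 * n) : ℝ) * Real.log p := by
        gcongr
        exact Nat.factorization_choose_le_log
    _ = ∑ p ∈ s, ((p.log (2 * n) : ℝ) - 1) * Real.log p + ∑ p ∈ s, Real.log p := by
        rw [← sum_add_distrib]
        exact sum_congr rfl fun p _ => by ring
    _ ≤ _ := by gcongr

theorem primeFactors_centralBinom_subset {n : ℕ} (hn : 2 < n) :
    n.centralBinom.primeFactors ⊆
      Nat.primesLE (2 * n / 3) ∪ (Nat.primesLE (2 * n) \ Nat.primesLE n) := by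
  intro p hp
  have hprime := Nat.prime_of_mem_primeFactors hp
  have hpos : 0 < n.centralBinom.factorization p :=
    hprime.factorization_pos_of_dvd n.centralBinom_ne_zero (Nat.dvd_of_mem_primeFactors hp)
  have hle : p ≤ 2 * n := Nat.le_two_mul_of_factorization_centralBinom_pos hpos
  have hgap : p ≤ n → 3 * p ≤ 2 * n := fun hpn => not_lt.1 fun hbig =>
    hpos.ne' (Nat.factorization_centralBinom_of_two_mul_self_lt_three_mul hn hpn hbig)
  simp only [mem_union, Finset.mem_sdiff, Nat.mem_primesLE, hprime, and_true]
  omega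

theorem sum_log_le_card_mul_log (n : ℕ) (s : Finset ℕ) (hs : s ⊆ Nat.primesLE n) :
    ∑ p ∈ s, Real.log p ≤ #s * Real.log n := by
  rw [← nsmul_eq_mul]
  refine sum_le_card_nsmul _ _ _ fun p hp => ?_
  obtain ⟨hpn, hp⟩ := Nat.mem_primesLE.1 (hs hp)
  exact Real.log_le_log (mod_cast hp.pos) (mod_cast hpn)

theorem mul_log_four_div_three_sub_le {n : ℕ} (hn : 4 ≤ n) :
    n * Real.log 4 / 3 - Real.log n - 2 * √↑(2 * n) * Real.log ↑(2 * n) ≤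
      #(Nat.primesLE (2 * n) \ Nat.primesLE n) * Real.log ↑(2 * n) := by
  have hcentral : n * Real.log 4 ≤ Real.log n + Real.log n.centralBinom := by
    rw [← Real.log_pow, ← Real.log_mul (by positivity) (mod_cast n.centralBinom_ne_zero)]
    exact Real.log_le_log (by positivity) (mod_cast (Nat.four_pow_lt_mul_centralBinom n hn).le)
  have hexcess : Chebyshev.psi ↑(2 * n) - Chebyshev.theta ↑(2 * n) ≤
      2 * √↑(2 * n) * Real.log ↑(2 * n) :=
    Chebyshev.psi_sub_theta_le (mod_cast by omega)
  have htheta : Chebyshev.theta ↑(2 * n / 3) ≤ Real.log 4 * (2 * n / 3) := by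
    refine (Chebyshev.theta_le_log4_mul_x (Nat.cast_nonneg _)).trans ?_
    gcongr
    exact_mod_cast Nat.cast_div_le (α := ℝ) (m := 2 * n) (n := 3)
  have hprimes : ∑ p ∈ n.centralBinom.primeFactors, Real.log p ≤
      Chebyshev.theta ↑(2 * n / 3) +
        #(Nat.primesLE (2 * n) \ Nat.primesLE n) * Real.log ↑(2 * n) :=
    calc ∑ p ∈ n.centralBinom.primeFactors, Real.log p
        ≤ ∑ p ∈ Nat.primesLE (2 * n / 3) ∪ (Nat.primesLE (2 * n) \ Nat.primesLE n),
            Real.log p :=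
          sum_le_sum_of_subset_of_nonneg (primeFactors_centralBinom_subset (by omega))
            fun p _ _ => Real.log_natCast_nonneg p
      _ = Chebyshev.theta ↑(2 * n / 3) +
            ∑ p ∈ Nat.primesLE (2 * n) \ Nat.primesLE n, Real.log p := by
          rw [Chebyshev.theta_eq_sum_primesLE_log, sum_union]
          refine disjoint_left.2 fun p hp hp' => (mem_sdiff.1 hp').2 ?_
          rw [Nat.mem_primesLE] at hp ⊢
          exact ⟨hp.1.trans (by omega), hp.2⟩
      _ ≤ _ := by
          gcongr
          exact sum_log_le_card_mul_log _ _ sdiff_subset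
  linarith [log_centralBinom_le_psi_sub_theta_add n]

theorem eventually_sqrt_mul_log_le {c : ℝ} (hc : 0 < c) :
    ∀ᶠ x : ℝ in atTop, √x * Real.log x ≤ c * x := by
  filter_upwards [(isLittleO_log_rpow_atTop (half_pos one_pos)).bound hc, eventually_ge_atTop 1]
    with x hx hx1
  rw [← Real.sqrt_eq_rpow, Real.norm_of_nonneg (Real.log_nonneg hx1),
    Real.norm_of_nonneg (Real.sqrt_nonneg x)] at hx
  calc √x * Real.log x ≤ √x * (c * √x) := by gcongr
    _ = c * x := by rw [mul_left_comm, Real.mul_self_sqrt (by linarith)]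

theorem eventually_div_four_le_card_mul_log :
    ∀ᶠ n : ℕ in atTop,
      (n : ℝ) / 4 ≤ #(Nat.primesLE (2 * n) \ Nat.primesLE n) * Real.log ↑(2 * n) := by
  have hsmall : ∀ᶠ n : ℕ in atTop,
      √↑(2 * n) * Real.log ↑(2 * n) ≤ 1 / 50 * ↑(2 * n) :=
    (tendsto_natCast_atTop_atTop.comp (tendsto_id.const_mul_atTop' two_pos)).eventually
      (eventually_sqrt_mul_log_le (by norm_num))
  filter_upwards [hsmall, eventually_ge_atTop 4] with n hsmall hn
  have hlog4 : 1.38 ≤ Real.log 4 := by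
    rw [show (4 : ℝ) = 2 ^ 2 by norm_num, Real.log_pow]
    linarith [Real.log_two_gt_d9]
  have hlog : Real.log n ≤ √↑(2 * n) * Real.log ↑(2 * n) :=
    calc Real.log n ≤ Real.log ↑(2 * n) :=
          Real.log_le_log (by positivity) (mod_cast by omega)
      _ ≤ √↑(2 * n) * Real.log ↑(2 * n) :=
          le_mul_of_one_le_left (Real.log_natCast_nonneg _)
            (Real.one_le_sqrt.2 (mod_cast by omega))
  have hmul : (n : ℝ) * 1.38 ≤ n * Real.log 4 := by gcongr
  have hcast : ((2 * n : ℕ) : ℝ) = 2 * n := by push_cast; rfl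
  linarith [mul_log_four_div_three_sub_le hn]

theorem finite_dyadicPrimes (X : ℝ) : (dyadicPrimes X).Finite :=
  (Set.finite_Iic ⌊2 * X⌋₊).subset fun _ hp => Nat.le_floor hp.2.2

theorem eventually_div_log_le_ncard_dyadicPrimes :
    ∀ᶠ X : ℝ in atTop, X / (16 * Real.log X) ≤ (dyadicPrimes X).ncard := by
  filter_upwards [tendsto_nat_floor_atTop.eventually eventually_div_four_le_card_mul_log,
    eventually_ge_atTop 2] with X hcount hX
  set n := ⌊X⌋₊
  have hnX : (n : ℝ) ≤ X := Nat.floor_le (by linarith)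
  have hXn : X < n + 1 := Nat.lt_floor_add_one X
  have hsub : (↑(Nat.primesLE (2 * n) \ Nat.primesLE n) : Set ℕ) ⊆ dyadicPrimes X := by
    intro p hp
    simp only [coe_sdiff, Set.mem_sdiff, mem_coe, Nat.mem_primesLE, not_and'] at hp
    obtain ⟨⟨hp2n, hp⟩, hpn⟩ := hp
    have hp2n : (p : ℝ) ≤ 2 * n := mod_cast hp2n
    exact ⟨hp, ((Nat.floor_lt (by linarith)).1 (not_le.1 (hpn hp))).le, by linarith⟩
  have hcard : (#(Nat.primesLE (2 * n) \ Nat.primesLE n) : ℝ) ≤ (dyadicPrimes X).ncard := by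
    rw [← Set.ncard_coe_finset]
    exact mod_cast Set.ncard_le_ncard hsub (finite_dyadicPrimes X)
  have hlog : Real.log ↑(2 * n) ≤ 2 * Real.log X :=
    calc Real.log ↑(2 * n) ≤ Real.log (X ^ 2) := by
          push_cast
          exact Real.log_le_log (by linarith) (by nlinarith)
      _ = 2 * Real.log X := by rw [Real.log_pow, Nat.cast_two]
  have hlogX : 0 < Real.log X := Real.log_pos (by linarith)
  rw [div_le_iff₀ (by positivity)]
  calc X ≤ 8 * (n / 4) := by linarith
    _ ≤ 8 * ((dyadicPrimes X).ncard * (2 * Real.log X)) := by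
        gcongr
        refine hcount.trans ?_
        gcongr
    _ = (dyadicPrimes X).ncard * (16 * Real.log X) := by ring

end Chebyshev

section Probability

open Finset Filter

theorem primeLaw_real_apply (X : ℝ) (S : Set ℕ) :
    (primeLaw X).real S = ((dyadicPrimes X ∩ S).ncard : ℝ) / (dyadicPrimes X).ncard := by
  have hfin := finite_dyadicPrimes X
  have hcount (T : Set ℕ) (hT : T.Finite) : (Measure.count T).toReal = T.ncard := by
    rw [Measure.count_apply .of_discrete, ← hT.cast_ncard_eq, ENat.toENNReal_coe,
      ENNReal.toReal_natCast]
  rw [primeLaw, uniformOn, measureReal_def, cond_apply .of_discrete, ENNReal.toReal_mul,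
    ENNReal.toReal_inv, hcount _ hfin, hcount _ (hfin.inter_of_left S), div_eq_inv_mul]

variable {m : ℕ} {h : Fin (m + 1) → ℕ}

theorem exists_dvd_add_of_residueCount_eq {p : ℕ} (hp : p.Prime) (hr : residueCount h p = p)
    (n : ℕ) : ∃ j, p ∣ n + h j := by
  have : NeZero p := ⟨hp.ne_zero⟩
  have huniv : univ.image (fun j => (h j : ZMod p)) = univ :=
    eq_univ_of_card _ (hr.trans (ZMod.card p).symm)
  obtain ⟨j, -, hj⟩ := mem_image.1 (huniv ▸ mem_univ (-(n : ZMod p)))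
  refine ⟨j, ?_⟩
  rw [← ZMod.natCast_eq_zero_iff, Nat.cast_add, hj, add_neg_cancel]

theorem not_constellation_of_residueCount_eq {p : ℕ} (hp : p.Prime) (hr : residueCount h p = p)
    {n : ℕ} (hn : m + 1 < n) : ¬ Constellation h n := by
  intro hprime
  obtain ⟨j, hj⟩ := exists_dvd_add_of_residueCount_eq hp hr n
  have heq : p = n + h j := (Nat.prime_dvd_prime_iff_eq hp (hprime j)).1 hj
  have hle : p ≤ m + 1 := hr ▸ residueCount_le h p
  omega

theorem IsAdmissible.inv_le_eulerFactor (hadm : IsAdmissible h) {p : ℕ} (hp : p.Prime) :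
    (p : ℝ)⁻¹ ≤ eulerFactor h p := by
  have hp0 : (0 : ℝ) < p := mod_cast hp.pos
  have hpos := one_sub_inv_pos hp.two_le
  have hinv : (p : ℝ)⁻¹ ≤ 1 - residueCount h p / p := by
    rw [one_sub_div hp0.ne', inv_eq_one_div]
    gcongr
    rw [le_sub_iff_add_le']
    exact mod_cast hadm p hp
  exact hinv.trans (le_div_self ((inv_nonneg.2 hp0.le).trans hinv) (pow_pos hpos _)
    (pow_le_one₀ hpos.le (sub_le_self _ (by positivity))))

theorem IsAdmissible.le_singularSeries (hadm : IsAdmissible h) (hh : StrictMono h) :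
    (2 * 4 ^ (2 * (m + 1) ^ 2) : ℝ)⁻¹ ≤ singularSeries h := by
  set w := 2 * (m + 1) ^ 2
  have hprimorial : (primorial w : ℝ) ≤ 4 ^ w := mod_cast primorial_le_four_pow w
  calc (2 * 4 ^ w : ℝ)⁻¹ = 1 / 2 * (4 ^ w)⁻¹ := by rw [mul_inv, inv_eq_one_div 2]
    _ ≤ 1 / 2 * (primorial w : ℝ)⁻¹ := by
        gcongr
        exact mod_cast primorial_pos w
    _ = 1 / 2 * ∏ p ∈ Nat.primesLE w, (p : ℝ)⁻¹ := by
        rw [prod_inv_distrib, ← Nat.cast_prod]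
        rfl
    _ ≤ 1 / 2 * ∏ p ∈ Nat.primesLE w, eulerFactor h p := by
        gcongr with p hp
        exact hadm.inv_le_eulerFactor (Nat.prime_of_mem_primesLE hp)
    _ ≤ singularSeries h := half_prod_le_singularSeries hh le_rfl

theorem prod_one_sub_residueCount_le (hh : StrictMono h) {z : ℕ} (hz2 : 2 ≤ z)
    (hz : 2 * (m + 1) ^ 2 ≤ z) :
    ∏ p ∈ Nat.primesLE z, (1 - (residueCount h p : ℝ) / p) ≤
      2 * singularSeries h / Real.log z ^ (m + 1) := by
  have hlog : 0 < Real.log z := Real.log_pos (mod_cast hz2)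
  have hnonneg := singularSeries_nonneg hh
  have hmertens := log_le_prod_primesLE_inv_one_sub_inv z
  set Q := ∏ p ∈ Nat.primesLE z, (1 - 1 / (p : ℝ))⁻¹ with hQ
  have hfactor : ∏ p ∈ Nat.primesLE z, eulerFactor h p =
      (∏ p ∈ Nat.primesLE z, (1 - (residueCount h p : ℝ) / p)) * Q ^ (m + 1) := by
    simp only [hQ, ← prod_pow, ← prod_mul_distrib, eulerFactor, inv_pow, div_eq_mul_inv]
  calc ∏ p ∈ Nat.primesLE z, (1 - (residueCount h p : ℝ) / p)
      ≤ 2 * singularSeries h / Q ^ (m + 1) := by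
        rw [le_div_iff₀ (pow_pos (hlog.trans_le hmertens) _)]
        linarith [half_prod_le_singularSeries hh hz]
    _ ≤ 2 * singularSeries h / Real.log z ^ (m + 1) := by gcongr

theorem exists_Ico_dyadicPrimes_subset {X : ℝ} (hX : 0 ≤ X) :
    ∃ a N : ℕ, (N : ℝ) ≤ X + 1 ∧ dyadicPrimes X ⊆ Set.Ico a (a + N) := by
  refine ⟨⌈X⌉₊, ⌊2 * X⌋₊ + 1 - ⌈X⌉₊, ?_, fun n hn => ⟨Nat.ceil_le.2 hn.2.1, ?_⟩⟩
  · have hceil : ⌈X⌉₊ ≤ ⌊2 * X⌋₊ + 1 := by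
      refine Nat.ceil_le.2 ?_
      push_cast
      linarith [Nat.lt_floor_add_one (2 * X)]
    rw [Nat.cast_sub hceil, Nat.cast_add_one]
    linarith [Nat.floor_le (show 0 ≤ 2 * X by positivity), Nat.le_ceil X]
  · have : n ≤ ⌊2 * X⌋₊ := Nat.le_floor hn.2.2
    omega

theorem Constellation.coprime_primorial {n z : ℕ} (hn : Constellation h n) (hz : z < n) :
    (primorial z).Coprime (∏ j, (n + h j)) := by
  refine Nat.Coprime.prod_right fun j _ => ((hn j).coprime_iff_not_dvd.2 fun hdvd => ?_).symm
  have := (hn j).dvd_primorial_iff.1 hdvd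
  omega

theorem IsAdmissible.pow_le_mul_singularSeries_div (hadm : IsAdmissible h) (hh : StrictMono h)
    {z s : ℕ} (hz : 2 ≤ z) {X : ℝ} (hzX : (z : ℝ) ^ (s + (m + 1)) ≤ X) :
    (z : ℝ) ^ s ≤ 2 * 4 ^ (2 * (m + 1) ^ 2) * X * (singularSeries h / Real.log z ^ (m + 1)) := by
  have hlog : 0 < Real.log z := Real.log_pos (mod_cast hz)
  have hX : 0 ≤ X := le_trans (by positivity) hzX
  calc (z : ℝ) ^ s ≤ X / Real.log z ^ (m + 1) := by
        rw [le_div_iff₀ (by positivity)]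
        refine le_trans ?_ hzX
        rw [pow_add (z : ℝ)]
        gcongr
        exact Real.log_le_self (by positivity)
    _ ≤ X / Real.log z ^ (m + 1) * (2 * 4 ^ (2 * (m + 1) ^ 2) * singularSeries h) :=
        le_mul_of_one_le_right (by positivity)
          ((inv_le_iff_one_le_mul₀' (by positivity)).1 (hadm.le_singularSeries hh))
    _ = _ := by ring

theorem IsAdmissible.ncard_constellation_le (hadm : IsAdmissible h) (hh : StrictMono h) {z : ℕ}
    (hz2 : 2 ≤ z) (hz : 2 * (m + 1) ^ 2 ≤ z) {X : ℝ}
    (hzX : (z : ℝ) ^ (6 * (6 * (m + 1) + 1) + (m + 1)) ≤ X) :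
    ((dyadicPrimes X ∩ {n | Constellation h n}).ncard : ℝ) ≤
      (8 + 2 * 4 ^ (2 * (m + 1) ^ 2)) * X * (singularSeries h / Real.log z ^ (m + 1)) := by
  set s := 6 * (6 * (m + 1) + 1)
  have hz1 : (1 : ℝ) < z := mod_cast hz2
  have hzltX : (z : ℝ) < X := (lt_self_pow₀ hz1 (by omega)).trans_le hzX
  have hX0 : 0 < X := by linarith
  have hnonneg := singularSeries_nonneg hh
  obtain ⟨a, N, hN, hsub⟩ := exists_Ico_dyadicPrimes_subset hX0.le
  have hcard : (dyadicPrimes X ∩ {n | Constellation h n}).ncard ≤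
      #{n ∈ Ico a (a + N) | (primorial z).Coprime (∏ j, (n + h j))} := by
    rw [← Set.ncard_coe_finset]
    refine Set.ncard_le_ncard (fun n hn => ?_)
    rw [mem_coe, mem_filter, mem_Ico]
    exact ⟨hsub hn.1, hn.2.coprime_primorial (mod_cast hzltX.trans_le hn.1.2.1)⟩
  calc ((dyadicPrimes X ∩ {n | Constellation h n}).ncard : ℝ)
      ≤ 2 * N * ∏ p ∈ Nat.primesLE z, (1 - (residueCount h p : ℝ) / p) + (z : ℝ) ^ s :=
        (Nat.cast_le.2 hcard).trans (card_coprime_prod_add_le hadm hz2 a N)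
    _ ≤ 2 * N * (2 * singularSeries h / Real.log z ^ (m + 1)) +
          2 * 4 ^ (2 * (m + 1) ^ 2) * X * (singularSeries h / Real.log z ^ (m + 1)) := by
        gcongr
        · exact prod_one_sub_residueCount_le hh hz2 hz
        · exact hadm.pow_le_mul_singularSeries_div hh hz2 hzX
    _ ≤ 2 * (2 * X) * (2 * singularSeries h / Real.log z ^ (m + 1)) +
          2 * 4 ^ (2 * (m + 1) ^ 2) * X * (singularSeries h / Real.log z ^ (m + 1)) := by
        gcongr
        linarith
    _ = _ := by ring

theorem eventually_exists_pow_le_log_le {r : ℕ} (hr : r ≠ 0) (w : ℕ) :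
    ∀ᶠ X : ℝ in atTop, ∃ z : ℕ, w ≤ z ∧ (z : ℝ) ^ r ≤ X ∧
      Real.log X ≤ 2 * r * Real.log z := by
  have hr0 : (0 : ℝ) < r := mod_cast Nat.pos_of_ne_zero hr
  filter_upwards [(tendsto_rpow_atTop (inv_pos.2 hr0)).eventually_ge_atTop (max w 2 : ℝ),
    eventually_gt_atTop 0] with X hX hX0
  set t := X ^ (r : ℝ)⁻¹
  obtain ⟨hwt, h2t⟩ := max_le_iff.1 hX
  have htpow : t ^ r = X := Real.rpow_inv_natCast_pow hX0.le hr
  have hfloor2 : (2 : ℝ) ≤ ⌊t⌋₊ := mod_cast Nat.le_floor (a := t) (mod_cast h2t)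
  refine ⟨⌊t⌋₊, Nat.le_floor hwt, ?_, ?_⟩
  · rw [← htpow]
    gcongr
    exact Nat.floor_le (by linarith)
  · have hsq : t ≤ (⌊t⌋₊ : ℝ) ^ 2 := by nlinarith [Nat.lt_floor_add_one t]
    calc Real.log X = r * Real.log t := by rw [← htpow, Real.log_pow]
      _ ≤ r * Real.log ((⌊t⌋₊ : ℝ) ^ 2) := by gcongr
      _ = 2 * r * Real.log ⌊t⌋₊ := by
          rw [Real.log_pow, Nat.cast_two]
          ring

theorem primeLaw_constellation_eq_zero (hadm : ¬ IsAdmissible h) {X : ℝ} (hX : m + 1 < X) :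
    (primeLaw X).real {n | Constellation h n} = 0 := by
  obtain ⟨p, hp, hpr⟩ : ∃ p : ℕ, p.Prime ∧ p ≤ residueCount h p := by
    simpa only [IsAdmissible, not_forall, not_lt, exists_prop] using hadm
  have hempty : dyadicPrimes X ∩ {n | Constellation h n} = ∅ :=
    Set.eq_empty_of_forall_notMem fun n hn => not_constellation_of_residueCount_eq hp
      ((residueCount_le_self h hp).antisymm hpr) (mod_cast hX.trans_le hn.1.2.1) hn.2
  rw [primeLaw_real_apply, hempty, Set.ncard_empty, Nat.cast_zero, zero_div]

theorem exists_primeLaw_constellation_le (m : ℕ) : ∃ C : ℝ, 1 ≤ C ∧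
    ∀ᶠ X : ℝ in atTop, ∀ h : Fin (m + 1) → ℕ, StrictMono h →
      (primeLaw X).real {n | Constellation h n} ≤ C * (singularSeries h / Real.log X ^ m) := by
  set r := 6 * (6 * (m + 1) + 1) + (m + 1)
  set K : ℝ := 8 + 2 * 4 ^ (2 * (m + 1) ^ 2)
  have hK : 8 ≤ K := le_add_of_nonneg_right (by positivity)
  have hr : 1 ≤ (2 * r : ℝ) ^ (m + 1) := one_le_pow₀ (mod_cast by omega)
  refine ⟨16 * K * (2 * r) ^ (m + 1), by nlinarith, ?_⟩
  filter_upwards [eventually_exists_pow_le_log_le (by omega : r ≠ 0) (max 2 (2 * (m + 1) ^ 2)),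
    eventually_div_log_le_ncard_dyadicPrimes, eventually_gt_atTop ((m : ℝ) + 1),
    eventually_gt_atTop 1] with X hlevel hcount hXm hX1 h hh
  have hlogX : 0 < Real.log X := Real.log_pos hX1
  have hnonneg := singularSeries_nonneg hh
  by_cases hadm : IsAdmissible h
  · obtain ⟨z, hwz, hzX, hlogz⟩ := hlevel
    obtain ⟨hz2, hzm⟩ := max_le_iff.1 hwz
    have hlogz0 : 0 < Real.log z := Real.log_pos (mod_cast hz2)
    have hdensity : singularSeries h / Real.log z ^ (m + 1) ≤
        singularSeries h * (2 * r) ^ (m + 1) / Real.log X ^ (m + 1) := by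
      rw [div_le_div_iff₀ (by positivity) (by positivity), mul_assoc, ← mul_pow]
      gcongr
    rw [primeLaw_real_apply]
    calc _ ≤ K * X * (singularSeries h / Real.log z ^ (m + 1)) / (X / (16 * Real.log X)) := by
          gcongr
          exact hadm.ncard_constellation_le hh hz2 hzm hzX
      _ ≤ K * X * (singularSeries h * (2 * r) ^ (m + 1) / Real.log X ^ (m + 1)) /
            (X / (16 * Real.log X)) := by gcongr
      _ = _ := by
          rw [pow_succ (Real.log X)]
          field_simp
  · rw [primeLaw_constellation_eq_zero hadm hXm]
    positivity

theorem primeLaw_exists_constellation_le {H : Finset (Fin (m + 1) → ℕ)} {X b : ℝ}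
    (hb : ∀ h ∈ H, (primeLaw X).real {n | Constellation h n} ≤ b) :
    (primeLaw X).real {n | ∃ h ∈ H, Constellation h n} ≤ #H * b := by
  have hunion : {n | ∃ h ∈ H, Constellation h n} = ⋃ h ∈ H, {n | Constellation h n} := by
    ext n
    simp only [Set.mem_ofPred_eq, Set.mem_iUnion, exists_prop]
  rw [hunion, ← nsmul_eq_mul]
  exact (measureReal_biUnion_finset_le _ _).trans (sum_le_card_nsmul _ _ _ hb)

theorem eventually_forall_last_le (H : Finset (Fin (m + 1) → ℕ)) :
    ∀ᶠ X : ℝ in atTop, ∀ h ∈ H, (h (Fin.last m) : ℝ) ≤ 2 * X :=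
  (eventually_all_finset H).2 fun h _ =>
    (tendsto_id.const_mul_atTop two_pos).eventually_ge_atTop (h (Fin.last m) : ℝ)

end Probability

theorem mainTheorem5 (m : ℕ) (hm : 1 ≤ m) :
    -- the Euler product defining the singular series converges
    (∀ h : Fin (m + 1) → ℕ, IsOffsetPattern h → Multipliable (singularFactor h)) ∧
    -- all constants depend on `m` only
    ∃ (C C' X₀ : ℝ) (A : ℕ), 0 < C ∧ 0 < C' ∧ 3 ≤ X₀ ∧
      -- one pattern, uniformly in the pattern
      (∀ X : ℝ, X₀ ≤ X → ∀ h : Fin (m + 1) → ℕ, IsOffsetPattern h →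
        (h (Fin.last m) : ℝ) ≤ 2 * X →
          (primeLaw X).real {p | Constellation h p}
              ≤ C * (singularSeries h / Real.log X ^ m) ∧
          singularSeries h / Real.log X ^ m
              ≤ C' * (Real.log (Real.log (3 * X)) ^ A / Real.log X ^ m)) ∧
      -- finite families, uniformly in the family, with offsets at most `2X`
      (∀ X : ℝ, X₀ ≤ X → ∀ H : Finset (Fin (m + 1) → ℕ),
        (∀ h ∈ H, IsOffsetPattern h ∧ (h (Fin.last m) : ℝ) ≤ 2 * X) →
          (primeLaw X).real {p | ∃ h ∈ H, Constellation h p}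
              ≤ C' * ((H.card : ℝ) * Real.log (Real.log (3 * X)) ^ A / Real.log X ^ m)) ∧
      -- an arbitrary fixed finite family, for `X` large in terms of the family
      (∀ H : Finset (Fin (m + 1) → ℕ), (∀ h ∈ H, IsOffsetPattern h) →
        ∃ X₁ : ℝ, ∀ X : ℝ, X₁ ≤ X →
          (primeLaw X).real {p | ∃ h ∈ H, Constellation h p}
              ≤ C' * ((H.card : ℝ) * Real.log (Real.log (3 * X)) ^ A / Real.log X ^ m)) := by
  refine ⟨fun h hh => multipliable_singularFactor hh.2, ?_⟩
  obtain ⟨C, hC, hprob⟩ := exists_primeLaw_constellation_le m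
  obtain ⟨X₀, hX₀⟩ :=
    Filter.eventually_atTop.1 (hprob.and (Filter.eventually_ge_atTop (Real.exp 2)))
  have hthree : 3 ≤ X₀ := by linarith [(hX₀ X₀ le_rfl).2, Real.add_one_le_exp (2 : ℝ)]
  set D : ℝ := (4 * Real.exp (6 + 8 * (m + 1) ^ 2)) ^ m
  have hseries (X : ℝ) (hX : X₀ ≤ X) (h : Fin (m + 1) → ℕ) (hh : IsOffsetPattern h)
      (hhX : (h (Fin.last m) : ℝ) ≤ 2 * X) : C * (singularSeries h / Real.log X ^ m) ≤
        C * D * (Real.log (Real.log (3 * X)) ^ m / Real.log X ^ m) := by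
    rw [mul_assoc]
    gcongr
    exact singularSeries_div_log_pow_le hh.2 (hX₀ X hX).2 hhX
  have hfamily (X : ℝ) (hX : X₀ ≤ X) (H : Finset (Fin (m + 1) → ℕ))
      (hH : ∀ h ∈ H, IsOffsetPattern h ∧ (h (Fin.last m) : ℝ) ≤ 2 * X) :
      (primeLaw X).real {p | ∃ h ∈ H, Constellation h p} ≤
        C * D * (H.card * Real.log (Real.log (3 * X)) ^ m / Real.log X ^ m) :=
    (primeLaw_exists_constellation_le fun h hh => ((hX₀ X hX).1 h (hH h hh).1.2).trans
      (hseries X hX h (hH h hh).1 (hH h hh).2)).trans_eq (by ring)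
  refine ⟨C, C * D, X₀, m, by positivity, by positivity, hthree, fun X hX h hh hhX =>
    ⟨(hX₀ X hX).1 h hh.2, (le_mul_of_one_le_left ?_ hC).trans (hseries X hX h hh hhX)⟩,
    hfamily, fun H hH => ?_⟩
  · exact div_nonneg (singularSeries_nonneg hh.2) (pow_nonneg (Real.log_nonneg (by linarith)) m)
  · obtain ⟨X₁, hX₁⟩ := Filter.eventually_atTop.1 (eventually_forall_last_le H)
    exact ⟨max X₀ X₁, fun X hX => hfamily X ((le_max_left _ _).trans hX) H fun h hh =>
      ⟨hH h hh, hX₁ X ((le_max_right _ _).trans hX) h hh⟩⟩
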